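/- Let $n\ge 3$, write $B_r(y)\subset\mathbb R^n$ for open balls and $B_1=B_1(0)$. A modulus of continuity on $[0,1]$ is a non-decreasing, continuous, subadditive function $\omega$ with $\omega(0)=0$; it is a Dini modulus of continuity if moreover $\int_0^1\frac{\omega(r)}{r}\,dr<\infty$. Let $W_0^{1,2}(B_1)$ be the closure of $C_c^\infty(B_1)$ in $W^{1,2}(B_1)$ and $W^{-1,2}(B_1)$ its dual. For $0<r<s$ put $$\|\psi(\cdot+y)\|_{L^{1,2}_{r,s}}=\frac{\|\psi\|_{L^2(B_s(y))}}{s-r}+\|\nabla\psi\|_{L^2(B_s(y))}.$$ There is a constant $K>0$ depending only on $n$, and for every $0<r_0\le 1$ a constant $K'>0$ depending only on $n$ and $r_0$, such that the following holds. Let $\Gamma=(\Gamma_1,\dots,\Gamma_n)\in L^2(B_1)^n$, let $C\ge 0$, and let $\omega_1$ be a modulus of continuity on $[0,1]$ such that for all $1\le i\le n$ and $0<r\le r_0$ $$\sup_{y\in B_1}\left(\frac{1}{|B_1\cap B_r(y)|}\int_{B_1\cap B_r(y)}|\Gamma_i|^2\,dx\right)^{1/2}\le C\,\frac{\omega_1(r)}{r},$$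 and $$\int_0^{r_0}\frac{\omega_1(r)^2}{r}\,dr<\infty,\qquad \int_0^{r_0}\frac1r\left(\int_0^r\frac{\omega_1(s)^2}{s}\,ds\right)^{1/2}dr<\infty .$$ Set $\omega(r)=\left(\int_0^r\frac{\omega_1(s)^2}{s}\,ds\right)^{1/2}$ and $V=\operatorname{div}\Gamma$ in $B_1$, acting as a multiplier by $\langle V\psi,\varphi\rangle=-\int_{B_1}\Gamma\cdot\nabla(\psi\varphi)\,dx$. Then: (a) $\omega$ is a Dini modulus of continuity on $[0,1]$. (b) For all $0<r\le\frac12$, all $y$ with $B_{2r}(y)\subset B_1$, all $\psi\in W^{1,2}(B_1)$ and all $\varphi\in W_0^{1,2}(B_1)$ with $\operatorname{supp}\varphi\subset\overline{B_r(y)}$, the function $\Gamma\cdot\nabla(\psi\varphi)=\Gamma\cdot(\varphi\nabla\psi+\psi\nabla\varphi)$ is integrable on $B_1$, and $$|\langle V\psi,\varphi\rangle|\le K'C\,\inf_{r<s\le 2r}\Big(\omega(s)\,\|\psi(\cdot+y)\|_{L^{1,2}_{r,s}}\Big)\,\|\nabla\varphi\|_{L^2(B_r(y))};$$ if moreover $2r\le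 r_0$, the same holds with $K$ in place of $K'$. (c) The inequalities in (b) also hold for every linear operator $V:W^{1,2}(B_1)\to W^{-1,2}(B_1)$ such that $V=\operatorname{div}\Gamma$ in $B_1$ in the distributional sense, that is, $\langle V\psi,\eta\rangle=-\int_{B_1}\Gamma\cdot\nabla(\psi\eta)\,dx$ for all $\psi\in W^{1,2}(B_1)$ and $\eta\in C_c^\infty(B_1)$. -/

import Mathlib

open MeasureTheory Set Metric

noncomputable section

/-- Euclidean space `ℝⁿ`. -/
abbrev EucSp (n : ℕ) : Type := EuclideanSpace ℝ (Fin n)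

/-- The unit ball `B₁` of `ℝⁿ`. -/
abbrev unitBall (n : ℕ) : Set (EucSp n) := ball 0 1

/-- Test functions `η ∈ C_c^∞(Ω)`. -/
def IsTest {n : ℕ} (Ω : Set (EucSp n)) (η : EucSp n → ℝ) : Prop :=
  ContDiff ℝ (⊤ : ℕ∞) η ∧ HasCompactSupport η ∧ tsupport η ⊆ Ω

/-- The Hilbert space `L²(Ω) × L²(Ω)ⁿ`, with norm `(‖u‖² + ‖g‖²)^(1/2)`. -/
abbrev L2Pair {n : ℕ} (Ω : Set (EucSp n)) : Type :=
  WithLp 2 (Lp ℝ 2 (volume.restrict Ω) × Lp (EucSp n) 2 (volume.restrict Ω))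

/-- `g` is the weak gradient of `u` in `Ω`: `∫ u ∇η = -∫ η g` for all test functions `η`. -/
def IsWeakGradient {n : ℕ} (Ω : Set (EucSp n)) (u : EucSp n → ℝ) (g : EucSp n → EucSp n) :
    Prop :=
  ∀ η : EucSp n → ℝ, IsTest Ω η →
    ∫ x in Ω, u x • gradient η x = - ∫ x in Ω, η x • g x

theorem integrable_smul_of_test {n : ℕ} {F : Type*} [NormedAddCommGroup F] [NormedSpace ℝ F]
    {Ω : Set (EucSp n)} {η : EucSp n → ℝ} (h : IsTest Ω η) {g : EucSp n → F}
    (hg : MemLp g 2 (volume.restrict Ω)) :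
    Integrable (fun x => η x • g x) (volume.restrict Ω) := by
  have hη : MemLp η 2 (volume.restrict Ω) :=
    h.1.continuous.memLp_of_hasCompactSupport h.2.1
  exact memLp_one_iff_integrable.1 (hg.smul (p := 2) (q := 2) (r := 1) hη)

theorem integrable_smul_gradient_of_test {n : ℕ} {Ω : Set (EucSp n)} {η : EucSp n → ℝ}
    (h : IsTest Ω η) {u : EucSp n → ℝ} (hu : MemLp u 2 (volume.restrict Ω)) :
    Integrable (fun x => u x • gradient η x) (volume.restrict Ω) := by
  have hc : Continuous (gradient η) :=
    (InnerProductSpace.toDual ℝ (EucSp n)).symm.continuous.comp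
      (h.1.continuous_fderiv (by simp))
  have hs : HasCompactSupport (gradient η) :=
    (h.2.1.fderiv (𝕜 := ℝ)).comp_left (map_zero (InnerProductSpace.toDual ℝ (EucSp n)).symm)
  exact memLp_one_iff_integrable.1 ((hc.memLp_of_hasCompactSupport (p := 2) hs).smul (q := 2) (r := 1) hu)

/-- The Sobolev space `W^{1,2}(Ω)`, realised as the space of pairs `(u, ∇u)` of `L²` classes where
`∇u` is the weak gradient of `u`; it carries the norm `(‖u‖² + ‖∇u‖²)^(1/2)`. -/
def W12 {n : ℕ} (Ω : Set (EucSp n)) : Submodule ℝ (L2Pair Ω) where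
  carrier := {p | IsWeakGradient Ω p.fst p.snd}
  zero_mem' := by
    intro η _
    have h1 : (fun x => ((0 : L2Pair Ω).fst x) • gradient η x)
        =ᵐ[volume.restrict Ω] fun _ => 0 := by
      filter_upwards [Lp.coeFn_zero ℝ 2 (volume.restrict Ω)] with x hx
      rw [WithLp.zero_fst, hx, Pi.zero_apply, zero_smul]
    have h2 : (fun x => η x • ((0 : L2Pair Ω).snd x))
        =ᵐ[volume.restrict Ω] fun _ => 0 := by
      filter_upwards [Lp.coeFn_zero (EucSp n) 2 (volume.restrict Ω)] with x hx
      rw [WithLp.zero_snd, hx, Pi.zero_apply, smul_zero]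
    rw [integral_congr_ae h1, integral_congr_ae h2]
    simp
  add_mem' := by
    intro p q hp hq η hη
    have h1 : (fun x => ((p + q).fst x) • gradient η x) =ᵐ[volume.restrict Ω]
        fun x => p.fst x • gradient η x + q.fst x • gradient η x := by
      filter_upwards [Lp.coeFn_add p.fst q.fst] with x hx
      rw [WithLp.add_fst, hx, Pi.add_apply, add_smul]
    have h2 : (fun x => η x • ((p + q).snd x)) =ᵐ[volume.restrict Ω]
        fun x => η x • p.snd x + η x • q.snd x := by
      filter_upwards [Lp.coeFn_add p.snd q.snd] with x hx
      rw [WithLp.add_snd, hx, Pi.add_apply, smul_add]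
    rw [integral_congr_ae h1, integral_congr_ae h2,
      integral_add (integrable_smul_gradient_of_test hη (Lp.memLp p.fst))
        (integrable_smul_gradient_of_test hη (Lp.memLp q.fst)),
      integral_add (integrable_smul_of_test hη (Lp.memLp p.snd))
        (integrable_smul_of_test hη (Lp.memLp q.snd)), hp η hη, hq η hη]
    abel
  smul_mem' := by
    intro c p hp η hη
    have h1 : (fun x => ((c • p).fst x) • gradient η x) =ᵐ[volume.restrict Ω]
        fun x => c • (p.fst x • gradient η x) := by
      filter_upwards [Lp.coeFn_smul c p.fst] with x hx
      rw [WithLp.smul_fst, hx, Pi.smul_apply, smul_assoc]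
    have h2 : (fun x => η x • ((c • p).snd x)) =ᵐ[volume.restrict Ω]
        fun x => c • (η x • p.snd x) := by
      filter_upwards [Lp.coeFn_smul c p.snd] with x hx
      rw [WithLp.smul_snd, hx, Pi.smul_apply, smul_comm]
    rw [integral_congr_ae h1, integral_congr_ae h2, integral_smul, integral_smul, hp η hη,
      smul_neg]

/-- (A representative of) the function `u` underlying an element of `W^{1,2}(Ω)`. -/
def sobVal {n : ℕ} {Ω : Set (EucSp n)} (u : W12 Ω) : EucSp n → ℝ := (u : L2Pair Ω).fst

/-- (A representative of) the weak gradient `∇u` of an element of `W^{1,2}(Ω)`. -/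
def sobGrad {n : ℕ} {Ω : Set (EucSp n)} (u : W12 Ω) : EucSp n → EucSp n :=
  (u : L2Pair Ω).snd

/-- The element `u` of `W^{1,2}(Ω)` is the class of a test function `η ∈ C_c^∞(Ω)`. -/
def IsTestClass {n : ℕ} {Ω : Set (EucSp n)} (u : W12 Ω) : Prop :=
  ∃ η : EucSp n → ℝ, IsTest Ω η ∧ sobVal u =ᵐ[volume.restrict Ω] η ∧
    sobGrad u =ᵐ[volume.restrict Ω] gradient η

/-- `W₀^{1,2}(Ω)`: the closure of `C_c^∞(Ω)` in `W^{1,2}(Ω)`. -/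
def W012 {n : ℕ} (Ω : Set (EucSp n)) : Submodule ℝ (W12 Ω) :=
  (Submodule.span ℝ {u : W12 Ω | IsTestClass u}).topologicalClosure

/-- `W^{-1,2}(Ω)`: the dual space of `W₀^{1,2}(Ω)`. -/
abbrev Wm12 {n : ℕ} (Ω : Set (EucSp n)) : Type := StrongDual ℝ (W012 Ω)

/-- The integrand `Γ · ∇(ψφ) = Γ · (φ ∇ψ + ψ ∇φ)`. -/
def divIntegrand {n : ℕ} {Ω : Set (EucSp n)} (Γ : EucSp n → EucSp n) (ψ φ : W12 Ω)
    (x : EucSp n) : ℝ :=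
  inner ℝ (Γ x) (sobVal φ x • sobGrad ψ x + sobVal ψ x • sobGrad φ x)

/-- The pairing `⟨(div Γ) ψ, φ⟩ = -∫_Ω Γ · ∇(ψφ)` of the multiplier `div Γ`. -/
def divForm {n : ℕ} {Ω : Set (EucSp n)} (Γ : EucSp n → EucSp n) (ψ φ : W12 Ω) : ℝ :=
  - ∫ x in Ω, divIntegrand Γ ψ φ x

/-- `V = div Γ` in `Ω`, for an operator `V` from `W^{1,2}(Ω)` to `W^{-1,2}(Ω)`: the distribution
`Vψ` is `η ↦ -∫_Ω Γ · ∇(ψη)`, `η ∈ C_c^∞(Ω)`. -/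
def IsDivOperator {n : ℕ} {Ω : Set (EucSp n)} (Γ : EucSp n → EucSp n)
    (V : W12 Ω →ₗ[ℝ] Wm12 Ω) : Prop :=
  ∀ (ψ : W12 Ω) (φ : W012 Ω), IsTestClass (φ : W12 Ω) → V ψ φ = divForm Γ ψ φ

/-- `supp φ ⊆ closure of B_r(y)` (essential support). -/
def SupportedInBall {n : ℕ} {Ω : Set (EucSp n)} (φ : W12 Ω) (y : EucSp n) (r : ℝ) : Prop :=
  ∀ᵐ x ∂(volume.restrict Ω), x ∉ closedBall y r → sobVal φ x = 0

/-- `‖ψ(· + y)‖_{L^{1,2}_{r,s}} = ‖ψ‖_{L²(B_s(y))} / (s - r) + ‖∇ψ‖_{L²(B_s(y))}`. -/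
def normL12 {n : ℕ} {Ω : Set (EucSp n)} (ψ : W12 Ω) (y : EucSp n) (r s : ℝ) : ℝ :=
  lpNorm (sobVal ψ) 2 (volume.restrict (ball y s)) / (s - r) +
    lpNorm (sobGrad ψ) 2 (volume.restrict (ball y s))

/-- Modulus of continuity on `[0,1]`: non-decreasing, continuous, subadditive, zero at zero. -/
structure IsModulus (ω : ℝ → ℝ) : Prop where
  zero : ω 0 = 0
  mono : MonotoneOn ω (Icc 0 1)
  cont : ContinuousOn ω (Icc 0 1)
  subadd : ∀ a b : ℝ, 0 ≤ a → 0 ≤ b → a + b ≤ 1 → ω (a + b) ≤ ω a + ω b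

/-- Dini modulus of continuity: a modulus of continuity with `∫₀¹ ω(r)/r dr < ∞`. -/
structure IsDiniModulus (ω : ℝ → ℝ) : Prop extends IsModulus ω where
  dini : IntegrableOn (fun r => ω r / r) (Ioc 0 1)

/-- The multiplier inequality for a pairing `T ψ φ = ⟨Vψ, φ⟩` on
`W^{1,2}(B₁) × W₀^{1,2}(B₁)`, at the radii `0 < r ≤ ρ`: if `B_{2r}(y) ⊆ B₁` and `φ` is supported
in the closure of `B_r(y)`, then
`|⟨Vψ, φ⟩| ≤ ω(s) ‖ψ(· + y)‖_{L^{1,2}_{r,s}} ‖∇φ‖_{L²(B_r(y))}` for all `r < s ≤ 2r`. -/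
def MultiplierBound {n : ℕ} (T : W12 (unitBall n) → W012 (unitBall n) → ℝ) (ω : ℝ → ℝ)
    (ρ : ℝ) : Prop :=
  ∀ (r : ℝ) (y : EucSp n), 0 < r → r ≤ ρ → ball y (2 * r) ⊆ unitBall n →
    ∀ (ψ : W12 (unitBall n)) (φ : W012 (unitBall n)), SupportedInBall (φ : W12 (unitBall n)) y r →
      ∀ s : ℝ, r < s → s ≤ 2 * r →
        |T ψ φ| ≤ ω s * normL12 ψ y r s *
          lpNorm (sobGrad (φ : W12 (unitBall n))) 2 (volume.restrict (ball y r))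

/-- `ω(r) = (∫₀^r ω₁(s)²/s ds)^{1/2}`. -/
def sqrtDini (ω₁ : ℝ → ℝ) (r : ℝ) : ℝ := √(∫ s in (0 : ℝ)..r, ω₁ s ^ 2 / s)

end

/-!
The measure `|Γ|² dx` satisfies the Morrey type bound `∫_{B_r} |Γ|² ≲ C² ω₁(r)² r^{n-2}`, so its
Newton potential is bounded:
`∫_{B_r(x)} |x - y|^{2-n} |Γ(y)|² dy ≲ C² ∫₀^r ω₁(s)²/s ds + C² ω₁(r)² ≲ C² ω(r)²`.
This is `newtonPotential_fieldMeasure_le` together with `sq_le_mul_sqrtDini_sq`. Mass at distance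
larger than `r` contributes at most `r^{2-n}` times the total mass, so it suffices to know the
bounds at radii up to `r`; for balls larger than `r₀` the total mass is controlled by a covering
with balls of radius `r₀`, which is where the dependence of `K'` on `r₀` comes from.

A bounded Newton potential gives the trace inequality `∫ φ² dν ≲ M ∫ |∇φ|²`, where `M` is the
supremum of the potential `u` of `ν`: expanding `|∇φ - (φ/u) ∇u|² ≥ 0` gives Barta's inequality
`∫ φ² (-Δu)/u ≤ ∫ |∇φ|²` (`integral_gradient_sq_div_le`), and `-Δu` is a multiple of `ν` while
`u ≤ M`. To stay with `C¹` functions the kernel is regularised to `(|z|² + ε²)^{1 - n/2}`, whose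
Laplacian is an explicit approximate identity (`traceConst_mul_integral_sq_le`). Mollification
extends the inequality to products of test functions and Sobolev functions
(`traceConst_mul_lintegral_sq_le`).

For `φ` supported in `closedBall y r`, the Cauchy-Schwarz inequality bounds `∫ Γ · (φ ∇ψ + ψ ∇φ)`
by `‖Γφ‖ ‖∇ψ‖ + ‖Γψ‖ ‖∇φ‖` with norms in `L²(B_r(y))`; the trace inequality is applied to `φ` and
to `χψ`, where `χ` is a cutoff function between `B_r(y)` and `B_s(y)`, which produces the norm
`L^{1,2}_{r,s}` (`integrableOn_divIntegrand_and_abs_divForm_le`).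

The function `ω` is subadditive by the triangle inequality in `L²(dt/t)` after the substitution
`s = rt` (`sqrtDini_subadd`). Finally, an abstract operator `V` agrees with the divergence form on
test functions, and cutting off an approximating sequence of `φ` to a compact subset of the unit
ball, where the divergence form is continuous, carries this over to `φ`
(`IsDivOperator.apply_eq`).
-/

open Filter Topology ENNReal

noncomputable section

/-! ### The regularised Newton kernel -/

/-- Integration by parts: the gradient is minus the adjoint of the divergence. -/
theorem integral_inner_gradient_eq_neg {n : ℕ} {g : EucSp n → ℝ} {F : EucSp n → EucSp n}
    (hg : ContDiff ℝ 1 g) (hgs : HasCompactSupport g) (hF : ContDiff ℝ 1 F) :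
    ∫ x, inner ℝ (gradient g x) (F x) =
      - ∫ x, g x * ∑ i, (fderiv ℝ F x (EuclideanSpace.single i 1)) i := by
  have hgd : Differentiable ℝ g := hg.differentiable one_ne_zero
  have hFd : Differentiable ℝ F := hF.differentiable one_ne_zero
  have hgc : Continuous (fderiv ℝ g) := hg.continuous_fderiv one_ne_zero
  have hFc : Continuous (fderiv ℝ F) := hF.continuous_fderiv one_ne_zero
  have hgs' : HasCompactSupport (fderiv ℝ g) := hgs.fderiv (𝕜 := ℝ)
  have hcF : ∀ i : Fin n, Continuous fun x => F x i := fun i => by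
    have := hF.continuous
    fun_prop
  have h0 : ∀ i : Fin n, ∀ x, HasFDerivAt (fun x => F x i)
      ((EuclideanSpace.proj i : EucSp n →L[ℝ] ℝ).comp (fderiv ℝ F x)) x := fun i x =>
    (EuclideanSpace.proj i : EucSp n →L[ℝ] ℝ).hasFDerivAt.comp x (hFd x).hasFDerivAt
  have hpt : ∀ x, inner ℝ (gradient g x) (F x) =
      ∑ i, F x i * fderiv ℝ g x (EuclideanSpace.single i 1) := fun x => by
    rw [PiLp.inner_apply]
    refine Finset.sum_congr rfl fun i _ => ?_
    rw [← toDual_gradient, InnerProductSpace.toDual_apply_apply,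
      EuclideanSpace.inner_single_right]
    simp
  have hi1 : ∀ i : Fin n,
      Integrable fun x => F x i * fderiv ℝ g x (EuclideanSpace.single i 1) := fun i => by
    refine Continuous.integrable_of_hasCompactSupport
      ((hcF i).mul (hgc.clm_apply continuous_const)) ?_
    exact HasCompactSupport.mul_left (hgs'.comp_left
      (g := fun L : EucSp n →L[ℝ] ℝ => L (EuclideanSpace.single i 1)) (by simp))
  have hi2 : ∀ i : Fin n,
      Integrable fun x => g x * (fderiv ℝ F x (EuclideanSpace.single i 1)) i := fun i => by
    refine Continuous.integrable_of_hasCompactSupport ?_ hgs.mul_right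
    have := hg.continuous
    fun_prop
  have hi3 : ∀ i : Fin n, Integrable fun x => F x i * g x := fun i =>
    Continuous.integrable_of_hasCompactSupport ((hcF i).mul hg.continuous) hgs.mul_left
  simp_rw [hpt, Finset.mul_sum]
  rw [integral_finsetSum _ fun i _ => hi1 i, integral_finsetSum _ fun i _ => hi2 i,
    ← Finset.sum_neg_distrib]
  refine Finset.sum_congr rfl fun i _ => ?_
  have hd : ∀ x, fderiv ℝ (fun x => F x i) x (EuclideanSpace.single i 1) =
      (fderiv ℝ F x (EuclideanSpace.single i 1)) i := fun x => by
    rw [(h0 i x).fderiv]; rfl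
  rw [integral_mul_fderiv_eq_neg_fderiv_mul_of_integrable _ (hi1 i) (hi3 i)
    (fun x _ => (h0 i x).differentiableAt) (fun x _ => hgd x)]
  · simp_rw [hd, mul_comm]
  · simp_rw [hd, mul_comm _ (g _)]; exact hi2 i

/-- The regularised Newton kernel `(|z|² + ε²)^{1 - n/2}`, which increases to `|z|^{2-n}` as
`ε → 0`. -/
def newtonKernel (n : ℕ) (ε : ℝ) (z : EucSp n) : ℝ := (‖z‖ ^ 2 + ε ^ 2) ^ (1 - n / 2 : ℝ)

/-- The vector field `(|z|² + ε²)^{-n/2} z`, a multiple of the gradient of `newtonKernel`. -/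
def newtonField (n : ℕ) (ε : ℝ) (z : EucSp n) : EucSp n := (‖z‖ ^ 2 + ε ^ 2) ^ (-(n / 2) : ℝ) • z

theorem hasFDerivAt_rpow_norm_sq_add {n : ℕ} {ε : ℝ} (hε : 0 < ε) (p : ℝ) (z : EucSp n) :
    HasFDerivAt (fun z : EucSp n => (‖z‖ ^ 2 + ε ^ 2) ^ p)
      ((2 * p * (‖z‖ ^ 2 + ε ^ 2) ^ (p - 1)) • innerSL ℝ z) z := by
  have h := ((hasStrictFDerivAt_norm_sq z).hasFDerivAt.add_const (ε ^ 2)).rpow_const (p := p)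
    (Or.inl (by positivity))
  refine h.congr_fderiv ?_
  ext v
  simp
  ring

theorem hasFDerivAt_newtonKernel {n : ℕ} {ε : ℝ} (hε : 0 < ε) (z : EucSp n) :
    HasFDerivAt (newtonKernel n ε) (innerSL ℝ (-(n - 2 : ℝ) • newtonField n ε z)) z := by
  have h : HasFDerivAt (newtonKernel n ε) _ z :=
    hasFDerivAt_rpow_norm_sq_add hε (1 - n / 2 : ℝ) z
  refine h.congr_fderiv ?_
  rw [newtonField, smul_smul, map_smul, show (1 - n / 2 - 1 : ℝ) = -(n / 2) by ring]
  congr 1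
  ring

theorem contDiff_newtonField {n : ℕ} {ε : ℝ} (hε : 0 < ε) : ContDiff ℝ 1 (newtonField n ε) := by
  unfold newtonField
  refine ContDiff.smul (ContDiff.rpow_const_of_ne ?_ fun z => by positivity) contDiff_id
  exact (contDiff_norm_sq ℝ).add contDiff_const

theorem continuous_newtonKernel {n : ℕ} {ε : ℝ} (hε : 0 < ε) : Continuous (newtonKernel n ε) :=
  continuous_iff_continuousAt.2 fun z => (hasFDerivAt_newtonKernel hε z).continuousAt

theorem newtonKernel_nonneg {n : ℕ} (ε : ℝ) (z : EucSp n) : 0 ≤ newtonKernel n ε z := by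
  unfold newtonKernel; positivity

theorem newtonKernel_le {n : ℕ} (hn : 3 ≤ n) {ε : ℝ} (hε : 0 < ε) (z : EucSp n) :
    newtonKernel n ε z ≤ (ε ^ 2) ^ (1 - n / 2 : ℝ) := by
  have : (3 : ℝ) ≤ n := by exact_mod_cast hn
  exact Real.rpow_le_rpow_of_nonpos (by positivity) (by nlinarith [sq_nonneg ‖z‖]) (by linarith)

theorem norm_newtonField_le {n : ℕ} (hn : 3 ≤ n) {ε : ℝ} (hε : 0 < ε) (z : EucSp n) :
    ‖newtonField n ε z‖ ≤ (ε ^ 2) ^ (1 - n / 2 : ℝ) / ε := by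
  have ht : 0 < ‖z‖ ^ 2 + ε ^ 2 := by positivity
  have h1 : ‖z‖ * ε ≤ ‖z‖ ^ 2 + ε ^ 2 := by nlinarith [sq_nonneg (‖z‖ - ε), norm_nonneg z]
  rw [le_div_iff₀ hε, newtonField, norm_smul, Real.norm_of_nonneg (by positivity), mul_assoc]
  refine le_trans ?_ (newtonKernel_le hn hε z)
  calc _ ≤ (‖z‖ ^ 2 + ε ^ 2) ^ (-(n / 2) : ℝ) * (‖z‖ ^ 2 + ε ^ 2) := by gcongr
    _ = newtonKernel n ε z := by
      rw [newtonKernel, sub_eq_neg_add, Real.rpow_add ht, Real.rpow_one]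

/-- The divergence is positive: the terms of order `|z|²` cancel, which leaves the factor `ε²`. -/
theorem divergence_newtonField {n : ℕ} {ε : ℝ} (hε : 0 < ε) (z : EucSp n) :
    ∑ i, (fderiv ℝ (newtonField n ε) z (EuclideanSpace.single i 1)) i =
      n * ε ^ 2 * (‖z‖ ^ 2 + ε ^ 2) ^ (-(n / 2) - 1 : ℝ) := by
  have h := (hasFDerivAt_rpow_norm_sq_add hε (-(n / 2) : ℝ) z).smul (hasFDerivAt_id z)
  have h' : fderiv ℝ (newtonField n ε) z = _ := h.fderiv
  rw [h']
  have ht : 0 < ‖z‖ ^ 2 + ε ^ 2 := by positivity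
  have e : (‖z‖ ^ 2 + ε ^ 2) ^ (-(n / 2) : ℝ) =
      (‖z‖ ^ 2 + ε ^ 2) ^ (-(n / 2) - 1 : ℝ) * (‖z‖ ^ 2 + ε ^ 2) := by
    rw [Real.rpow_sub_one ht.ne']; field_simp
  have hz : ∑ i, z i * z i = ‖z‖ ^ 2 := by
    rw [EuclideanSpace.norm_sq_eq]; simp [sq]
  simp [EuclideanSpace.inner_single_right, Finset.sum_add_distrib, mul_assoc, ← Finset.mul_sum, hz]
  rw [e]
  ring

/-! ### Newton potentials and Barta's inequality -/

/-- The Newton potential of `ν` for the regularised kernel. -/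
def newtonPotential {n : ℕ} (ν : Measure (EucSp n)) (ε : ℝ) (x : EucSp n) : ℝ :=
  ∫ y, newtonKernel n ε (x - y) ∂ν

theorem integrable_newtonField {n : ℕ} (hn : 3 ≤ n) (ν : Measure (EucSp n)) [IsFiniteMeasure ν]
    {ε : ℝ} (hε : 0 < ε) (x : EucSp n) : Integrable (fun y => newtonField n ε (x - y)) ν := by
  refine Integrable.of_bound (C := (ε ^ 2) ^ (1 - n / 2 : ℝ) / ε) ?_
    (ae_of_all _ fun y => norm_newtonField_le hn hε _)
  exact ((contDiff_newtonField hε).continuous.comp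
    (continuous_const.sub continuous_id)).aestronglyMeasurable

theorem hasFDerivAt_newtonPotential {n : ℕ} (hn : 3 ≤ n) (ν : Measure (EucSp n))
    [IsFiniteMeasure ν] {ε : ℝ} (hε : 0 < ε) (x : EucSp n) :
    HasFDerivAt (newtonPotential ν ε)
      (innerSL ℝ (-(n - 2 : ℝ) • ∫ y, newtonField n ε (x - y) ∂ν)) x := by
  have hcK : Continuous (newtonKernel n ε) := continuous_newtonKernel hε
  have hcF : Continuous (newtonField n ε) := (contDiff_newtonField hε).continuous
  have hF : ∀ x, Continuous fun y => newtonField n ε (x - y) := fun x => by fun_prop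
  have hK : ∀ x, Continuous fun y => newtonKernel n ε (x - y) := fun x => by fun_prop
  have hI : Integrable (fun y => newtonKernel n ε (x - y)) ν :=
    Integrable.of_bound (C := (ε ^ 2) ^ (1 - n / 2 : ℝ)) (hK x).aestronglyMeasurable
      (ae_of_all _ fun y => by
        rw [Real.norm_of_nonneg (newtonKernel_nonneg _ _)]; exact newtonKernel_le hn hε _)
  have hm : AEStronglyMeasurable
      (fun y => innerSL ℝ (-(n - 2 : ℝ) • newtonField n ε (x - y))) ν :=
    ((innerSL ℝ).continuous.comp ((hF x).const_smul (-(n - 2 : ℝ)))).aestronglyMeasurable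
  have hb : ∀ z y, ‖innerSL ℝ (-(n - 2 : ℝ) • newtonField n ε (z - y))‖ ≤
      |(n - 2 : ℝ)| * ((ε ^ 2) ^ (1 - n / 2 : ℝ) / ε) := fun z y => by
    rw [innerSL_apply_norm, norm_smul, norm_neg, Real.norm_eq_abs]
    gcongr
    exact norm_newtonField_le hn hε _
  have hd : ∀ z y, HasFDerivAt (fun x => newtonKernel n ε (x - y))
      (innerSL ℝ (-(n - 2 : ℝ) • newtonField n ε (z - y))) z := fun z y =>
    (hasFDerivAt_comp_sub y).2 (hasFDerivAt_newtonKernel hε (z - y))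
  have h := hasFDerivAt_integral_of_dominated_of_fderiv_le (μ := ν) (𝕜 := ℝ)
    (F := fun x y => newtonKernel n ε (x - y)) (s := univ) (x₀ := x) Filter.univ_mem
    (Filter.Eventually.of_forall fun x => (hK x).aestronglyMeasurable) hI hm
    (ae_of_all _ fun y z _ => hb z y) (integrable_const _) (ae_of_all _ fun y z _ => hd z y)
  refine HasFDerivAt.congr_fderiv h ?_
  have h1 := ContinuousLinearMap.integral_comp_comm (innerSL ℝ (E := EucSp n))
    ((integrable_newtonField hn ν hε x).smul (-(n - 2 : ℝ)))
  rw [← integral_smul]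
  exact h1

theorem continuous_integral_newtonField {n : ℕ} (hn : 3 ≤ n) (ν : Measure (EucSp n))
    [IsFiniteMeasure ν] {ε : ℝ} (hε : 0 < ε) :
    Continuous fun x => ∫ y, newtonField n ε (x - y) ∂ν := by
  have hcF : Continuous (newtonField n ε) := (contDiff_newtonField hε).continuous
  refine continuous_of_dominated (bound := fun _ => (ε ^ 2) ^ (1 - n / 2 : ℝ) / ε)
    (fun x => (show Continuous fun y => newtonField n ε (x - y) by fun_prop).aestronglyMeasurable)
    (fun x => ae_of_all _ fun y => norm_newtonField_le hn hε _) (integrable_const _)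
    (ae_of_all _ fun y => by fun_prop)

theorem contDiff_newtonPotential {n : ℕ} (hn : 3 ≤ n) (ν : Measure (EucSp n))
    [IsFiniteMeasure ν] {ε : ℝ} (hε : 0 < ε) : ContDiff ℝ 1 (newtonPotential ν ε) := by
  rw [contDiff_one_iff_fderiv]
  refine ⟨fun x => (hasFDerivAt_newtonPotential hn ν hε x).differentiableAt, ?_⟩
  rw [show fderiv ℝ (newtonPotential ν ε) = _ from
    funext fun x => (hasFDerivAt_newtonPotential hn ν hε x).fderiv]
  exact (innerSL ℝ).continuous.comp ((continuous_integral_newtonField hn ν hε).const_smul (-(n - 2 : ℝ)))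

theorem gradient_newtonPotential {n : ℕ} (hn : 3 ≤ n) (ν : Measure (EucSp n))
    [IsFiniteMeasure ν] {ε : ℝ} (hε : 0 < ε) (x : EucSp n) :
    gradient (newtonPotential ν ε) x = -(n - 2 : ℝ) • ∫ y, newtonField n ε (x - y) ∂ν :=
  (hasGradientAt_iff_hasFDerivAt.2 (hasFDerivAt_newtonPotential hn ν hε x)).gradient

/-- The function `-Δ newtonKernel`, a positive approximate identity up to a factor: it is of
size `ε⁻ⁿ` on the ball of radius `ε`. -/
def newtonDelta (n : ℕ) (ε : ℝ) (z : EucSp n) : ℝ :=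
  (n - 2) * (n * ε ^ 2 * (‖z‖ ^ 2 + ε ^ 2) ^ (-(n / 2) - 1 : ℝ))

theorem gradient_continuous_of_contDiff {n : ℕ} {g : EucSp n → ℝ} (hg : ContDiff ℝ 1 g) :
    Continuous (gradient g) :=
  (InnerProductSpace.toDual ℝ (EucSp n)).symm.continuous.comp
      (hg.continuous_fderiv one_ne_zero)

theorem hasCompactSupport_gradient {n : ℕ} {g : EucSp n → ℝ} (hg : HasCompactSupport g) :
    HasCompactSupport (gradient g) :=
  (hg.fderiv (𝕜 := ℝ)).comp_left (map_zero (InnerProductSpace.toDual ℝ (EucSp n)).symm)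

/-- The weak form of `-Δu = newtonDelta ∗ ν` for the potential `u` of `ν`. -/
theorem integral_gradient_inner_gradient_newtonPotential {n : ℕ} (hn : 3 ≤ n)
    (ν : Measure (EucSp n)) [IsFiniteMeasure ν] {ε : ℝ} (hε : 0 < ε) {g : EucSp n → ℝ}
    (hg : ContDiff ℝ 1 g) (hgs : HasCompactSupport g) :
    ∫ x, inner ℝ (gradient g x) (gradient (newtonPotential ν ε) x) =
      ∫ y, (∫ x, g x * newtonDelta n ε (x - y)) ∂ν := by
  have hcF : Continuous (newtonField n ε) := (contDiff_newtonField hε).continuous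
  have hG := gradient_continuous_of_contDiff hg
  have hint : Integrable (fun p : EucSp n × EucSp n =>
      inner ℝ (gradient g p.1) (newtonField n ε (p.1 - p.2))) (volume.prod ν) := by
    have h1 : Integrable (fun x => ‖gradient g x‖) := (hG.integrable_of_hasCompactSupport
      (hasCompactSupport_gradient hgs)).norm
    refine (h1.mul_prod (integrable_const (μ := ν) ((ε ^ 2) ^ (1 - n / 2 : ℝ) / ε))).mono'
      (by fun_prop) (ae_of_all _ fun p => ?_)
    refine (norm_inner_le_norm _ _).trans ?_
    gcongr
    exact norm_newtonField_le hn hε _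
  have hx : ∀ x, inner ℝ (gradient g x) (gradient (newtonPotential ν ε) x) =
      -(n - 2 : ℝ) * ∫ y, inner ℝ (gradient g x) (newtonField n ε (x - y)) ∂ν := fun x => by
    rw [gradient_newtonPotential hn ν hε, inner_smul_right,
      integral_inner (integrable_newtonField hn ν hε x) (gradient g x)]
  simp_rw [hx]
  rw [integral_const_mul, integral_integral_swap hint, ← integral_const_mul]
  refine integral_congr_ae (ae_of_all _ fun y => ?_)
  have hF : ContDiff ℝ 1 fun x => newtonField n ε (x - y) :=
    (contDiff_newtonField hε).comp (contDiff_id.sub contDiff_const)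
  simp only
  rw [integral_inner_gradient_eq_neg hg hgs hF, neg_mul_neg, ← integral_const_mul]
  congr 1 with x
  rw [fderiv_comp_sub, divergence_newtonField hε, newtonDelta]
  ring

/-- Barta's inequality `∫ (-Δu / u) φ² ≤ ∫ |∇φ|²` for a positive function `u`, with `-Δu` in the
weak form. -/
theorem integral_gradient_sq_div_le {n : ℕ} {u φ : EucSp n → ℝ} (hu : ContDiff ℝ 1 u)
    (hu0 : ∀ x, 0 < u x) (hφ : ContDiff ℝ 1 φ) (hs : HasCompactSupport φ) :
    ∫ x, inner ℝ (gradient (fun x => φ x ^ 2 / u x) x) (gradient u x) ≤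
      ∫ x, ‖gradient φ x‖ ^ 2 := by
  have hg : ContDiff ℝ 1 fun x => φ x ^ 2 / u x := (hφ.pow 2).div hu fun x => (hu0 x).ne'
  have hgs : HasCompactSupport fun x => φ x ^ 2 / u x := by
    refine hs.mono' fun x hx => subset_tsupport _ fun h => hx ?_
    simp [h]
  have hG := gradient_continuous_of_contDiff hg
  have hU := gradient_continuous_of_contDiff hu
  have hF := gradient_continuous_of_contDiff hφ
  refine integral_mono ?_ ?_ fun x => ?_
  · exact (hG.inner hU).integrable_of_hasCompactSupport
      ((hasCompactSupport_gradient hgs).mono fun x hx h => hx (by simp [h]))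
  · exact (hF.norm.pow 2).integrable_of_hasCompactSupport
      ((hasCompactSupport_gradient hs).mono fun x hx h => hx (by simp [h]))
  have hφx := (hφ.differentiable one_ne_zero x).hasGradientAt
  have hux := (hu.differentiable one_ne_zero x).hasGradientAt
  have hgx : gradient (fun x => φ x ^ 2 / u x) x =
      (2 * (φ x / u x)) • gradient φ x - ((φ x / u x) ^ 2) • gradient u x := by
    refine HasGradientAt.gradient (hasGradientAt_iff_hasFDerivAt.2 ?_)
    have := HasFDerivAt.fun_mul ((hasGradientAt_iff_hasFDerivAt.1 hφx).pow 2)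
      ((hasDerivAt_inv (hu0 x).ne').comp_hasFDerivAt x (hasGradientAt_iff_hasFDerivAt.1 hux))
    simp only [Function.comp_apply, ← div_eq_mul_inv] at this
    refine this.congr_fderiv ?_
    ext v
    have := (hu0 x).ne'
    simp
    field_simp
    ring
  simp only
  rw [hgx, inner_sub_left, inner_smul_left, inner_smul_left, real_inner_self_eq_norm_sq]
  -- The difference of the two sides is the square of the norm of `∇φ - (φ/u) ∇u`.
  have h := sq_nonneg ‖gradient φ x - (φ x / u x) • gradient u x‖
  rw [norm_sub_sq_real, inner_smul_right, norm_smul, mul_pow, Real.norm_eq_abs, sq_abs] at h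
  simp only [conj_trivial]
  linarith

theorem newtonDelta_nonneg {n : ℕ} (hn : 3 ≤ n) (ε : ℝ) (z : EucSp n) :
    0 ≤ newtonDelta n ε z := by
  have : (3 : ℝ) ≤ n := by exact_mod_cast hn
  have : (0 : ℝ) ≤ n - 2 := by linarith
  unfold newtonDelta
  positivity

theorem continuous_newtonDelta {n : ℕ} {ε : ℝ} (hε : 0 < ε) : Continuous (newtonDelta n ε) := by
  unfold newtonDelta
  refine continuous_const.mul (continuous_const.mul ?_)
  exact Continuous.rpow_const (by fun_prop) fun z => Or.inl (by positivity)

theorem newtonDelta_ge {n : ℕ} (hn : 3 ≤ n) {ε : ℝ} (hε : 0 < ε) {z : EucSp n} (hz : ‖z‖ ≤ ε) :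
    (n - 2) * n * 2 ^ (-(n / 2) - 1 : ℝ) * (ε ^ n)⁻¹ ≤ newtonDelta n ε z := by
  have h3 : (3 : ℝ) ≤ n := by exact_mod_cast hn
  have h2 : (0 : ℝ) ≤ n - 2 := by linarith
  have h1 : (2 * ε ^ 2) ^ (-(n / 2) - 1 : ℝ) ≤ (‖z‖ ^ 2 + ε ^ 2) ^ (-(n / 2) - 1 : ℝ) :=
    Real.rpow_le_rpow_of_nonpos (by positivity) (by nlinarith [norm_nonneg z]) (by linarith)
  have h4 : (2 * ε ^ 2) ^ (-(n / 2) - 1 : ℝ) =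
      2 ^ (-(n / 2) - 1 : ℝ) * ((ε ^ n)⁻¹ * (ε ^ 2)⁻¹) := by
    rw [Real.mul_rpow (by positivity) (by positivity)]
    congr 1
    rw [← Real.rpow_natCast ε 2, ← Real.rpow_natCast ε n, ← Real.rpow_mul hε.le,
      ← Real.rpow_neg hε.le, ← Real.rpow_neg hε.le, ← Real.rpow_add hε]
    congr 1
    push_cast
    ring
  unfold newtonDelta
  rw [h4] at h1
  calc _ = (n - 2) * (n * ε ^ 2 * (2 ^ (-(n / 2) - 1 : ℝ) * ((ε ^ n)⁻¹ * (ε ^ 2)⁻¹))) := by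
        field_simp
    _ ≤ _ := by gcongr

/-! ### The trace inequality for smooth functions -/

/-- The constant of the trace inequality: a lower bound, independent of `ε`, for the integral of
`newtonDelta n ε` over the ball of radius `ε`. -/
def traceConst (n : ℕ) : ℝ :=
  (n - 2) * n * 2 ^ (-(n / 2) - 1 : ℝ) * (volume (ball (0 : EucSp n) 1)).toReal

theorem traceConst_pos {n : ℕ} (hn : 3 ≤ n) : 0 < traceConst n := by
  have h3 : (3 : ℝ) ≤ n := by exact_mod_cast hn
  have h2 : (0 : ℝ) < n - 2 := by linarith
  have : 0 < (volume (ball (0 : EucSp n) 1)).toReal :=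
    ENNReal.toReal_pos (measure_ball_pos _ _ one_pos).ne' measure_ball_lt_top.ne
  unfold traceConst
  positivity

theorem volume_real_ball {n : ℕ} (y : EucSp n) {r : ℝ} (hr : 0 < r) :
    (volume (ball y r)).toReal = r ^ n * (volume (ball (0 : EucSp n) 1)).toReal := by
  rw [Measure.addHaar_ball_of_pos _ _ hr, ENNReal.toReal_mul, finrank_euclideanSpace_fin,
    ENNReal.toReal_ofReal (by positivity)]

theorem integrable_integral_mul_newtonDelta {n : ℕ} (hn : 3 ≤ n) (ν : Measure (EucSp n))
    [IsFiniteMeasure ν] {ε : ℝ} (hε : 0 < ε) {g : EucSp n → ℝ} (hg : Continuous g)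
    (hgs : HasCompactSupport g) :
    Integrable (fun y => ∫ x, g x * newtonDelta n ε (x - y)) ν := by
  have hcD : Continuous (newtonDelta n ε) := continuous_newtonDelta hε
  have hb : ∀ z, ‖newtonDelta n ε z‖ ≤ (n - 2) * (n * ε ^ 2 * (ε ^ 2) ^ (-(n / 2) - 1 : ℝ)) := by
    intro z
    have h3 : (3 : ℝ) ≤ n := by exact_mod_cast hn
    have h2 : (0 : ℝ) ≤ n - 2 := by linarith
    rw [Real.norm_of_nonneg (newtonDelta_nonneg hn ε z), newtonDelta]
    have : (‖z‖ ^ 2 + ε ^ 2) ^ (-(n / 2) - 1 : ℝ) ≤ (ε ^ 2) ^ (-(n / 2) - 1 : ℝ) :=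
      Real.rpow_le_rpow_of_nonpos (by positivity) (by nlinarith [norm_nonneg z]) (by linarith)
    gcongr
  have h1 : Integrable (fun p : EucSp n × EucSp n => g p.1 * newtonDelta n ε (p.1 - p.2))
      (volume.prod ν) := by
    refine (((hg.integrable_of_hasCompactSupport hgs).norm.mul_prod
      (integrable_const (μ := ν)
        ((n - 2) * (n * ε ^ 2 * (ε ^ 2) ^ (-(n / 2) - 1 : ℝ)))))).mono'
      (by fun_prop) (ae_of_all _ fun p => ?_)
    rw [norm_mul]
    gcongr
    exact hb _
  exact h1.integral_prod_right

/-- The trace inequality at scale `ε`: Barta's inequality for the regularised potential, with `u`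
replaced by its upper bound. -/
theorem integral_integral_sq_mul_newtonDelta_le {n : ℕ} (hn : 3 ≤ n) (ν : Measure (EucSp n))
    [IsFiniteMeasure ν] {φ : EucSp n → ℝ} (hφ : ContDiff ℝ 1 φ) (hs : HasCompactSupport φ)
    {M ε : ℝ} (hM0 : 0 ≤ M) (hε : 0 < ε) (hM : ∀ x ∈ tsupport φ, newtonPotential ν ε x ≤ M) :
    ∫ y, (∫ x, φ x ^ 2 * newtonDelta n ε (x - y)) ∂ν ≤ M * ∫ x, ‖gradient φ x‖ ^ 2 := by
  have hcD : Continuous (newtonDelta n ε) := continuous_newtonDelta hε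
  have hD0 : 0 ≤ ∫ x, ‖gradient φ x‖ ^ 2 := integral_nonneg fun x => by positivity
  have hsq : HasCompactSupport fun x => φ x ^ 2 := hs.mono fun x hx h => hx (by simp [h])
  -- Adding `η > 0` to the potential makes it positive also when `ν = 0`.
  have key : ∀ η : ℝ, 0 < η → ∫ y, (∫ x, φ x ^ 2 * newtonDelta n ε (x - y)) ∂ν ≤
      (M + η) * ∫ x, ‖gradient φ x‖ ^ 2 := by
    intro η hη
    have hu : ContDiff ℝ 1 fun x => newtonPotential ν ε x + η :=
      (contDiff_newtonPotential hn ν hε).add contDiff_const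
    have hP0 : ∀ x, 0 ≤ newtonPotential ν ε x := fun x =>
      integral_nonneg fun y => newtonKernel_nonneg _ _
    have hu0 : ∀ x, 0 < newtonPotential ν ε x + η := fun x => by linarith [hP0 x]
    have hgr : ∀ x, gradient (fun x => newtonPotential ν ε x + η) x =
        gradient (newtonPotential ν ε) x := fun x => by
      simp [gradient]
    have h := integral_gradient_sq_div_le hu hu0 hφ hs
    simp_rw [hgr] at h
    have hg : ContDiff ℝ 1 fun x => φ x ^ 2 / (newtonPotential ν ε x + η) :=
      (hφ.pow 2).div hu fun x => (hu0 x).ne'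
    have hgs : HasCompactSupport fun x => φ x ^ 2 / (newtonPotential ν ε x + η) :=
      hs.mono fun x hx h => hx (by simp [h])
    rw [integral_gradient_inner_gradient_newtonPotential hn ν hε hg hgs] at h
    have hMη : 0 < M + η := by linarith
    refine le_trans ?_ (mul_le_mul_of_nonneg_left h hMη.le)
    rw [← integral_const_mul]
    refine integral_mono (integrable_integral_mul_newtonDelta hn ν hε (hφ.continuous.pow 2) hsq)
      ((integrable_integral_mul_newtonDelta hn ν hε hg.continuous hgs).const_mul _) fun y => ?_
    simp only
    rw [← integral_const_mul]
    have hcd : Continuous fun x => newtonDelta n ε (x - y) := by fun_prop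
    refine integral_mono
      (((hφ.continuous.pow 2).mul hcd).integrable_of_hasCompactSupport hsq.mul_right)
      (((hg.continuous.mul hcd).integrable_of_hasCompactSupport hgs.mul_right).const_mul _)
      fun x => ?_
    simp only
    rw [← mul_assoc]
    refine mul_le_mul_of_nonneg_right ?_ (newtonDelta_nonneg hn ε _)
    by_cases hx : x ∈ tsupport φ
    · rw [← mul_div_assoc, le_div_iff₀ (hu0 x), mul_comm]
      exact mul_le_mul_of_nonneg_right (by linarith [hM x hx]) (sq_nonneg _)
    · simp [image_eq_zero_of_notMem_tsupport hx]
  refine le_of_forall_pos_le_add fun τ hτ => ?_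
  refine (key (τ / ((∫ x, ‖gradient φ x‖ ^ 2) + 1)) (by positivity)).trans ?_
  rw [add_mul]
  gcongr
  rw [div_mul_eq_mul_div, div_le_iff₀ (by positivity)]
  nlinarith

/-- Trace inequality: the Newton potential of `ν` controls the embedding of `W^{1,2}` in
`L²(ν)`. -/
theorem traceConst_mul_integral_sq_le {n : ℕ} (hn : 3 ≤ n) (ν : Measure (EucSp n))
    [IsFiniteMeasure ν] {φ : EucSp n → ℝ} (hφ : ContDiff ℝ 1 φ) (hs : HasCompactSupport φ)
    {M : ℝ} (hM0 : 0 ≤ M) (hM : ∀ ε : ℝ, 0 < ε → ∀ x ∈ tsupport φ, newtonPotential ν ε x ≤ M) :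
    traceConst n * ∫ x, φ x ^ 2 ∂ν ≤ M * ∫ x, ‖gradient φ x‖ ^ 2 := by
  have hsq : HasCompactSupport fun x => φ x ^ 2 := hs.mono fun x hx h => hx (by simp [h])
  have hcsq : Continuous fun x => φ x ^ 2 := hφ.continuous.pow 2
  have huc := hsq.uniformContinuous_of_continuous hcsq
  rw [Metric.uniformContinuous_iff] at huc
  have hiν : Integrable (fun x => φ x ^ 2) ν := by
    obtain ⟨B, hB⟩ := hsq.exists_bound_of_continuous hcsq
    exact Integrable.of_bound hcsq.aestronglyMeasurable B (ae_of_all _ hB)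
  have hc0 := traceConst_pos hn
  have key : ∀ τ : ℝ, 0 < τ → traceConst n * ∫ x, φ x ^ 2 ∂ν ≤
      M * (∫ x, ‖gradient φ x‖ ^ 2) + traceConst n * (τ * ν.real univ) := by
    intro τ hτ
    obtain ⟨ε, hε, hεφ⟩ := huc τ hτ
    have hcD : Continuous (newtonDelta n ε) := continuous_newtonDelta hε
    have h := integral_integral_sq_mul_newtonDelta_le hn ν hφ hs hM0 hε (hM ε hε)
    -- On the ball of radius `ε` around `y` the function `φ ^ 2` is at least `φ y ^ 2 - τ`.
    have hpt : ∀ y, traceConst n * (φ y ^ 2 - τ) ≤ ∫ x, φ x ^ 2 * newtonDelta n ε (x - y) := by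
      intro y
      have hcd : Continuous fun x => newtonDelta n ε (x - y) := by fun_prop
      have hi : Integrable fun x => φ x ^ 2 * newtonDelta n ε (x - y) :=
        (hcsq.mul hcd).integrable_of_hasCompactSupport hsq.mul_right
      have h0 : ∀ x, 0 ≤ φ x ^ 2 * newtonDelta n ε (x - y) := fun x =>
        mul_nonneg (sq_nonneg _) (newtonDelta_nonneg hn ε _)
      by_cases hy : φ y ^ 2 - τ ≤ 0
      · exact (mul_nonpos_of_nonneg_of_nonpos hc0.le hy).trans (integral_nonneg h0)
      push Not at hy
      refine le_trans ?_ (setIntegral_le_integral (s := ball y ε) hi (ae_of_all _ h0))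
      have hconst : traceConst n * (φ y ^ 2 - τ) = ∫ x in ball y ε, (φ y ^ 2 - τ) *
          ((n - 2) * n * 2 ^ (-(n / 2) - 1 : ℝ) * (ε ^ n)⁻¹) := by
        rw [setIntegral_const, smul_eq_mul, measureReal_def, volume_real_ball y hε, traceConst]
        field_simp
      rw [hconst]
      refine setIntegral_mono_on (integrableOn_const measure_ball_lt_top.ne) hi.integrableOn
        measurableSet_ball fun x hx => ?_
      have hd := hεφ (a := x) (b := y) (by simpa using hx)
      rw [Real.dist_eq, abs_lt] at hd
      have h3 : (3 : ℝ) ≤ n := by exact_mod_cast hn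
      have h2 : (0 : ℝ) ≤ n - 2 := by linarith
      refine mul_le_mul (by linarith) (newtonDelta_ge hn hε ?_) (by positivity) (sq_nonneg _)
      rw [← dist_eq_norm]
      exact (mem_ball.1 hx).le
    have h5 : ∫ y, traceConst n * (φ y ^ 2 - τ) ∂ν ≤
        ∫ y, (∫ x, φ x ^ 2 * newtonDelta n ε (x - y)) ∂ν :=
      integral_mono ((hiν.sub (integrable_const τ)).const_mul _)
        (integrable_integral_mul_newtonDelta hn ν hε hcsq hsq) hpt
    rw [integral_const_mul, integral_sub hiν (integrable_const _), integral_const] at h5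
    simp only [smul_eq_mul] at h5
    nlinarith
  refine le_of_forall_pos_le_add fun δ hδ => ?_
  refine (key (δ / (traceConst n * (ν.real univ + 1))) (by positivity)).trans ?_
  gcongr
  have : 0 ≤ ν.real univ := measureReal_nonneg
  rw [div_mul_eq_mul_div, mul_div_assoc', div_le_iff₀ (by positivity)]
  nlinarith [mul_pos hδ hc0]

/-! ### The trace inequality for compactly supported Sobolev functions -/

/-- Jensen's inequality for the square and a measure of mass at most one. -/
theorem lintegral_sq_le_lintegral_sq {α : Type*} [MeasurableSpace α] {μ : Measure α}
    (hμ : μ univ ≤ 1) {g : α → ℝ≥0∞} (hg : AEMeasurable g μ) :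
    (∫⁻ a, g a ∂μ) ^ 2 ≤ ∫⁻ a, g a ^ 2 ∂μ := by
  have h := ENNReal.lintegral_mul_le_Lp_mul_Lq μ Real.HolderConjugate.two_two hg
    (aemeasurable_const (b := (1 : ℝ≥0∞)))
  simp only [Pi.mul_apply, mul_one, ENNReal.one_rpow, lintegral_const, one_mul] at h
  have h2 : (∫⁻ a, g a ∂μ) ≤ (∫⁻ a, g a ^ (2 : ℝ) ∂μ) ^ (1 / 2 : ℝ) := by
    refine h.trans (mul_le_of_le_one_right' ?_)
    exact ENNReal.rpow_le_one hμ (by norm_num)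
  calc _ ≤ ((∫⁻ a, g a ^ (2 : ℝ) ∂μ) ^ (1 / 2 : ℝ)) ^ 2 := by gcongr
    _ = _ := by
      rw [← ENNReal.rpow_natCast, ← ENNReal.rpow_mul]
      norm_num

/-- Averaging against a probability density does not increase the `L²` norm. -/
theorem lintegral_enorm_integral_smul_sq_le {n : ℕ} {F : Type*} [NormedAddCommGroup F]
    [NormedSpace ℝ F] {ρ : EucSp n → ℝ} (hρc : Continuous ρ) (hρ0 : ∀ x, 0 ≤ ρ x)
    (hρi : Integrable ρ) (hρ1 : ∫ x, ρ x = 1) {G : EucSp n → F}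
    (hG : AEStronglyMeasurable G) :
    ∫⁻ x, ‖∫ y, ρ (x - y) • G y‖ₑ ^ 2 ≤ ∫⁻ y, ‖G y‖ₑ ^ 2 := by
  have hρl : ∫⁻ x, ENNReal.ofReal (ρ x) = 1 := by
    rw [← ofReal_integral_eq_lintegral_ofReal hρi (ae_of_all _ hρ0), hρ1, ENNReal.ofReal_one]
  have hm : ∀ x : EucSp n, Measurable fun y => ENNReal.ofReal (ρ (x - y)) := fun x =>
    (show Continuous fun y => ρ (x - y) by fun_prop).measurable.ennreal_ofReal
  have hpt : ∀ x, ‖∫ y, ρ (x - y) • G y‖ₑ ^ 2 ≤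
      ∫⁻ y, ENNReal.ofReal (ρ (x - y)) * ‖G y‖ₑ ^ 2 := by
    intro x
    have h1 : ‖∫ y, ρ (x - y) • G y‖ₑ ≤ ∫⁻ y, ENNReal.ofReal (ρ (x - y)) * ‖G y‖ₑ := by
      refine (enorm_integral_le_lintegral_enorm _).trans (lintegral_mono fun y => ?_)
      rw [enorm_smul, Real.enorm_of_nonneg (hρ0 _)]
    have h2 : ∀ g : EucSp n → ℝ≥0∞, AEMeasurable g → ∫⁻ y, ENNReal.ofReal (ρ (x - y)) * g y =
        ∫⁻ y, g y ∂(volume.withDensity fun y => ENNReal.ofReal (ρ (x - y))) := fun g hg =>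
      (lintegral_withDensity_eq_lintegral_mul₀ (hm x).aemeasurable hg).symm
    rw [h2 _ hG.enorm] at h1
    rw [h2 _ (hG.enorm.pow_const 2)]
    refine (pow_le_pow_left₀ zero_le h1 2).trans (lintegral_sq_le_lintegral_sq ?_ ?_)
    · rw [withDensity_apply _ MeasurableSet.univ, Measure.restrict_univ,
        lintegral_sub_left_eq_self (fun z => ENNReal.ofReal (ρ z)) x, hρl]
    · exact hG.enorm.mono_ac (withDensity_absolutelyContinuous _ _)
  calc _ ≤ ∫⁻ x, ∫⁻ y, ENNReal.ofReal (ρ (x - y)) * ‖G y‖ₑ ^ 2 := lintegral_mono hpt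
    _ = ∫⁻ y, ∫⁻ x, ENNReal.ofReal (ρ (x - y)) * ‖G y‖ₑ ^ 2 := by
      refine lintegral_lintegral_swap (AEMeasurable.fun_mul (f := fun p : EucSp n × EucSp n =>
        ENNReal.ofReal (ρ (p.1 - p.2))) ?_ ?_)
      · exact (show Continuous fun p : EucSp n × EucSp n => ρ (p.1 - p.2) by
          fun_prop).measurable.ennreal_ofReal.aemeasurable
      · exact (hG.enorm.pow_const 2).comp_snd
    _ = ∫⁻ y, ‖G y‖ₑ ^ 2 := by
      refine lintegral_congr fun y => ?_
      rw [lintegral_mul_const _ (show Continuous fun x => ρ (x - y) by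
          fun_prop).measurable.ennreal_ofReal,
        lintegral_sub_right_eq_self (fun z => ENNReal.ofReal (ρ z)) y, hρl, one_mul]

theorem innerSL_gradient {n : ℕ} (f : EucSp n → ℝ) (x : EucSp n) :
    innerSL ℝ (gradient f x) = fderiv ℝ f x := by
  ext v
  rw [← toDual_gradient]
  rfl

/-- The gradient of a mollification is the mollification of the weak gradient. -/
theorem gradient_convolution {n : ℕ} {ρ : EucSp n → ℝ} (hρ : ContDiff ℝ (⊤ : ℕ∞) ρ)
    (hρs : HasCompactSupport ρ) {f : EucSp n → ℝ} {G : EucSp n → EucSp n}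
    (hf : LocallyIntegrable f) (hfG : IsWeakGradient univ f G) (x : EucSp n) :
    gradient (convolution ρ f (ContinuousLinearMap.lsmul ℝ ℝ) volume) x =
      ∫ y, ρ (x - y) • G y := by
  have h := hρs.hasFDerivAt_convolution_left (ContinuousLinearMap.lsmul ℝ ℝ) (hρ.of_le (by simp))
    hf x
  refine HasGradientAt.gradient (hasGradientAt_iff_hasFDerivAt.2 (HasFDerivAt.congr_fderiv h ?_))
  have hηd : ContDiff ℝ (⊤ : ℕ∞) fun t => ρ (x - t) := hρ.comp (contDiff_const.sub contDiff_id)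
  have hηs : HasCompactSupport fun t => ρ (x - t) :=
    hρs.comp_homeomorph (Homeomorph.subLeft x)
  have hgr : ∀ t, gradient (fun t => ρ (x - t)) t = -gradient ρ (x - t) := by
    intro t
    have h1 : HasFDerivAt ρ (fderiv ℝ ρ (x - t)) (x - t) :=
      (hρ.differentiable (by simp) _).hasFDerivAt
    refine HasGradientAt.gradient (hasGradientAt_iff_hasFDerivAt.2 ?_)
    have h2 := HasFDerivAt.comp t h1 ((hasFDerivAt_id t).const_sub x)
    refine HasFDerivAt.congr_fderiv h2 ?_
    ext v
    simp
  have hw := hfG _ ⟨hηd, hηs, subset_univ _⟩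
  simp only [hgr, Measure.restrict_univ, smul_neg, integral_neg, neg_inj] at hw
  have hgc : Continuous (gradient ρ) := gradient_continuous_of_contDiff (hρ.of_le (by simp))
  have hi : Integrable fun t => f t • gradient ρ (x - t) := by
    refine hf.integrable_smul_right_of_hasCompactSupport (by fun_prop) ?_
    exact (hasCompactSupport_gradient hρs).comp_homeomorph (Homeomorph.subLeft x)
  change _ = innerSL ℝ _
  rw [convolution_eq_swap, ← hw, ← ContinuousLinearMap.integral_comp_comm _ hi]
  refine integral_congr_ae (ae_of_all _ fun t => ?_)
  simp only
  rw [map_smul, innerSL_gradient]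
  ext v
  simp [ContinuousLinearMap.precompL_apply, mul_comm]

/-- The trace inequality for a compactly supported Sobolev function `f` with weak gradient `G`, by
mollification: the `L²` norm of the gradient does not increase, and Fatou's lemma applies on the
other side because the mollifications converge almost everywhere. -/
theorem traceConst_mul_lintegral_sq_le {n : ℕ} (hn : 3 ≤ n) {ν : Measure (EucSp n)}
    [IsFiniteMeasure ν] (hν : ν ≪ volume) {U K : Set (EucSp n)} (hU : IsOpen U)
    (hK : IsCompact K) (hKU : K ⊆ U) {M : ℝ} (hM0 : 0 ≤ M)
    (hM : ∀ ε : ℝ, 0 < ε → ∀ x ∈ U, newtonPotential ν ε x ≤ M)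
    {f : EucSp n → ℝ} {G : EucSp n → EucSp n} (hf : MemLp f 2) (hG : MemLp G 2)
    (hfK : Function.support f ⊆ K) (hfG : IsWeakGradient univ f G) :
    ENNReal.ofReal (traceConst n) * ∫⁻ x, ‖f x‖ₑ ^ 2 ∂ν ≤
      ENNReal.ofReal M * ∫⁻ x, ‖G x‖ₑ ^ 2 := by
  obtain ⟨δ, hδ, hδU⟩ := hK.exists_cthickening_subset_open hU hKU
  have hfl : LocallyIntegrable f := hf.locallyIntegrable (by norm_num)
  let φ : ℕ → ContDiffBump (0 : EucSp n) := fun k =>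
    ⟨δ / 2 / (k + 1), δ / (k + 1), by positivity, by gcongr; linarith⟩
  have hφ0 : Tendsto (fun k => (φ k).rOut) atTop (𝓝 0) :=
    tendsto_const_div_atTop_nhds_zero_nat δ |>.comp (tendsto_add_atTop_nat 1) |>.congr
      fun k => by simp [φ]
  have hφK : ∀ᶠ k in atTop, (φ k).rOut ≤ 2 * (φ k).rIn :=
    Eventually.of_forall fun k => le_of_eq (by simp only [φ]; ring)
  have hae := ContDiffBump.ae_convolution_tendsto_right_of_locallyIntegrable hφ0 hφK hfl
  set fk : ℕ → EucSp n → ℝ := fun k =>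
    convolution ((φ k).normed volume) f (ContinuousLinearMap.lsmul ℝ ℝ) volume with hfk
  have hcd : ∀ k, ContDiff ℝ 1 (fk k) := fun k =>
    (φ k).hasCompactSupport_normed.contDiff_convolution_left (n := 1) _
      (φ k).contDiff_normed hfl
  have hts : ∀ k, tsupport (fk k) ⊆ cthickening δ K := by
    intro k
    refine closure_minimal ?_ isClosed_cthickening
    refine (support_convolution_subset _).trans ?_
    rintro _ ⟨a, ha, b, hb, rfl⟩
    rw [(φ k).support_normed_eq, mem_ball_zero_iff] at ha
    refine mem_cthickening_of_dist_le _ b _ _ (hfK hb) ?_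
    rw [dist_eq_norm, add_sub_cancel_right]
    refine ha.le.trans ?_
    exact div_le_self hδ.le (by simp)
  have hcs : ∀ k, HasCompactSupport (fk k) := fun k =>
    HasCompactSupport.of_support_subset_isCompact hK.cthickening (subset_closure.trans (hts k))
  have hbound : ∀ k, ENNReal.ofReal (traceConst n) * ∫⁻ x, ‖fk k x‖ₑ ^ 2 ∂ν ≤
      ENNReal.ofReal M * ∫⁻ x, ‖G x‖ₑ ^ 2 := by
    intro k
    have h := traceConst_mul_integral_sq_le hn ν (hcd k) (hcs k) hM0
      fun ε hε x hx => hM ε hε x (hδU (hts k hx))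
    have hsq : HasCompactSupport fun x => fk k x ^ 2 :=
      (hcs k).mono fun x hx h => hx (by simp [h])
    have hi1 : Integrable (fun x => fk k x ^ 2) ν := by
      obtain ⟨B, hB⟩ := hsq.exists_bound_of_continuous ((hcd k).continuous.pow 2)
      exact Integrable.of_bound ((hcd k).continuous.pow 2).aestronglyMeasurable B
        (ae_of_all _ hB)
    have hi2 : Integrable fun x => ‖gradient (fk k) x‖ ^ 2 :=
      ((gradient_continuous_of_contDiff (hcd k)).norm.pow 2).integrable_of_hasCompactSupport
        ((hasCompactSupport_gradient (hcs k)).mono fun x hx h => hx (by simp [h]))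
    have h' := ENNReal.ofReal_le_ofReal h
    rw [ENNReal.ofReal_mul (traceConst_pos hn).le, ENNReal.ofReal_mul hM0,
      ofReal_integral_eq_lintegral_ofReal hi1 (ae_of_all _ fun x => sq_nonneg _),
      ofReal_integral_eq_lintegral_ofReal hi2 (ae_of_all _ fun x => sq_nonneg _)] at h'
    have e1 : ∀ x, ENNReal.ofReal (fk k x ^ 2) = ‖fk k x‖ₑ ^ 2 := fun x => by
      rw [← sq_abs, ENNReal.ofReal_pow (abs_nonneg _), Real.enorm_eq_ofReal_abs]
    have e2 : ∀ x, ENNReal.ofReal (‖gradient (fk k) x‖ ^ 2) =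
        ‖∫ y, (φ k).normed volume (x - y) • G y‖ₑ ^ 2 := fun x => by
      rw [ENNReal.ofReal_pow (norm_nonneg _), ofReal_norm, hfk,
        gradient_convolution (φ k).contDiff_normed (φ k).hasCompactSupport_normed hfl hfG]
    simp_rw [e1, e2] at h'
    refine h'.trans (mul_le_mul_right ?_ _)
    exact lintegral_enorm_integral_smul_sq_le (φ k).continuous_normed
      (fun x => (φ k).nonneg_normed x) (φ k).integrable_normed (φ k).integral_normed hG.1
  calc ENNReal.ofReal (traceConst n) * ∫⁻ x, ‖f x‖ₑ ^ 2 ∂ν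
      = ENNReal.ofReal (traceConst n) * ∫⁻ x, liminf (fun k => ‖fk k x‖ₑ ^ 2) atTop ∂ν := by
        congr 1
        refine lintegral_congr_ae ?_
        filter_upwards [hν.ae_le hae] with x hx
        refine (Tendsto.liminf_eq ?_).symm
        exact ENNReal.Tendsto.pow ((continuous_enorm.tendsto _).comp hx)
    _ ≤ ENNReal.ofReal (traceConst n) * liminf (fun k => ∫⁻ x, ‖fk k x‖ₑ ^ 2 ∂ν) atTop := by
        gcongr
        exact lintegral_liminf_le fun k => ((hcd k).continuous.enorm.measurable).pow_const 2
    _ = liminf (fun k => ENNReal.ofReal (traceConst n) * ∫⁻ x, ‖fk k x‖ₑ ^ 2 ∂ν) atTop :=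
        (ENNReal.liminf_const_mul_of_ne_top ENNReal.ofReal_ne_top).symm
    _ ≤ _ := by
        refine (liminf_le_liminf (Eventually.of_forall hbound)).trans ?_
        simp

/-! ### Cutoff functions and products with test functions -/

theorem gradient_eq_zero_of_eventuallyEq_const {n : ℕ} {f : EucSp n → ℝ} {c : ℝ} {x : EucSp n}
    (h : f =ᶠ[𝓝 x] fun _ => c) : gradient f x = 0 := by
  rw [gradient, h.fderiv_eq]
  simp

theorem gradient_eq_zero_of_notMem_tsupport {n : ℕ} {f : EucSp n → ℝ} {x : EucSp n}
    (h : x ∉ tsupport f) : gradient f x = 0 :=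
  gradient_eq_zero_of_eventuallyEq_const (notMem_tsupport_iff_eventuallyEq.1 h)

theorem exists_bound_deriv_smoothTransition :
    ∃ B : ℝ, 0 < B ∧ ∀ t, |deriv Real.smoothTransition t| ≤ B := by
  have hc : Continuous (deriv Real.smoothTransition) :=
    (Real.smoothTransition.contDiff (n := 1)).continuous_deriv (by simp)
  obtain ⟨B, hB⟩ := isCompact_Icc.exists_bound_of_continuousOn (s := Icc (0 : ℝ) 1) hc.continuousOn
  refine ⟨max B 1, by positivity, fun t => ?_⟩
  rcases lt_or_ge t 0 with h | h
  · have : Real.smoothTransition =ᶠ[𝓝 t] fun _ => 0 := by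
      filter_upwards [Iio_mem_nhds h] with z hz
      exact Real.smoothTransition.zero_of_nonpos (le_of_lt hz)
    rw [this.deriv_eq]
    simp
  rcases le_or_gt t 1 with h1 | h1
  · exact (hB t ⟨h, h1⟩).trans (le_max_left _ _)
  · have : Real.smoothTransition =ᶠ[𝓝 t] fun _ => 1 := by
      filter_upwards [Ioi_mem_nhds h1] with z hz
      exact Real.smoothTransition.one_of_one_le (le_of_lt hz)
    rw [this.deriv_eq]
    simp

/-- Smooth cutoff functions between concentric balls, with the expected bound on the gradient. -/
theorem exists_cutoff : ∃ B : ℝ, 0 < B ∧ ∀ {n : ℕ} (y : EucSp n) (r s : ℝ), 0 < r → r < s →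
    ∃ χ : EucSp n → ℝ, IsTest (ball y s) χ ∧ (∀ x ∈ closedBall y r, χ x = 1) ∧
      (∀ x, |χ x| ≤ 1) ∧ ∀ x, ‖gradient χ x‖ ≤ B / (s - r) := by
  obtain ⟨B, hB0, hB⟩ := exists_bound_deriv_smoothTransition
  refine ⟨4 * B, by positivity, fun {n} y r s hr hrs => ?_⟩
  -- The support has to be compact in the open ball, so the cutoff vanishes from `b < s` on.
  set b := (r + s) / 2 with hb
  have hrb : r < b := by linarith
  have hbs : b < s := by linarith
  have hbr : 0 < b ^ 2 - r ^ 2 := by nlinarith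
  set w : EucSp n → ℝ := fun x => (b ^ 2 - ‖x - y‖ ^ 2) / (b ^ 2 - r ^ 2) with hw
  have hwd : ContDiff ℝ (⊤ : ℕ∞) w := by
    refine ContDiff.div_const (contDiff_const.sub ?_) _
    exact (contDiff_id.sub contDiff_const).norm_sq ℝ
  set χ : EucSp n → ℝ := fun x => Real.smoothTransition (w x) with hχ
  have hχd : ContDiff ℝ (⊤ : ℕ∞) χ := Real.smoothTransition.contDiff.comp hwd
  have hts : tsupport χ ⊆ closedBall y b := by
    refine closure_minimal (fun x hx => ?_) isClosed_closedBall
    by_contra h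
    refine hx (Real.smoothTransition.zero_of_nonpos ?_)
    rw [mem_closedBall, dist_eq_norm, not_le] at h
    exact div_nonpos_of_nonpos_of_nonneg (by nlinarith) hbr.le
  refine ⟨χ, ⟨hχd, ?_, ?_⟩, fun x hx => ?_, fun x => ?_, fun x => ?_⟩
  · exact HasCompactSupport.of_support_subset_isCompact (isCompact_closedBall y b)
      (subset_closure.trans hts)
  · exact hts.trans (closedBall_subset_ball hbs)
  · refine Real.smoothTransition.one_of_one_le ?_
    rw [mem_closedBall, dist_eq_norm] at hx
    rw [hw, le_div_iff₀ hbr]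
    nlinarith [norm_nonneg (x - y)]
  · rw [abs_of_nonneg (Real.smoothTransition.nonneg _)]
    exact Real.smoothTransition.le_one _
  · by_cases hx : x ∈ tsupport χ
    · have hxb : ‖x - y‖ ≤ b := by simpa [dist_eq_norm] using hts hx
      have h1 : HasFDerivAt (fun x : EucSp n => ‖x - y‖ ^ 2) (2 • innerSL ℝ (x - y)) x :=
        (hasFDerivAt_comp_sub (f := fun z : EucSp n => ‖z‖ ^ 2) y).2
          (hasStrictFDerivAt_norm_sq (x - y)).hasFDerivAt
      have h2 : HasFDerivAt w ((b ^ 2 - r ^ 2)⁻¹ •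
          (-((2 : ℕ) • innerSL ℝ (x - y)) : EucSp n →L[ℝ] ℝ)) x := by
        have := (h1.const_sub (b ^ 2)).const_smul (b ^ 2 - r ^ 2)⁻¹
        refine this.congr_of_eventuallyEq (Eventually.of_forall fun z => ?_)
        simp only [hw, Pi.smul_apply, smul_eq_mul]
        ring
      have h3 : HasFDerivAt χ _ x := HasDerivAt.comp_hasFDerivAt x
        (Real.smoothTransition.contDiff (n := 1) |>.differentiable one_ne_zero
          (w x)).hasDerivAt h2
      have h4 : ‖gradient χ x‖ = ‖fderiv ℝ χ x‖ := by
        rw [← innerSL_gradient, innerSL_apply_norm]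
      rw [h4, h3.fderiv, norm_smul, norm_smul, norm_neg, Real.norm_eq_abs, norm_inv,
        Real.norm_of_nonneg hbr.le, ← Nat.cast_smul_eq_nsmul ℝ, norm_smul, innerSL_apply_norm]
      have h5 : (b ^ 2 - r ^ 2)⁻¹ * (‖((2 : ℕ) : ℝ)‖ * ‖x - y‖) ≤ 4 / (s - r) := by
        have hsr : s - r = 2 * (b - r) := by rw [hb]; ring
        rw [inv_mul_le_iff₀ hbr, hsr]
        have : (b ^ 2 - r ^ 2) * (4 / (2 * (b - r))) = 2 * (b + r) := by
          have : b - r ≠ 0 := by linarith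
          field_simp
          ring
        rw [this]
        norm_num
        linarith
      calc _ ≤ B * (4 / (s - r)) := by
            refine mul_le_mul (hB _) h5 (by positivity) hB0.le
        _ = _ := by ring
    · rw [gradient_eq_zero_of_notMem_tsupport hx, norm_zero]
      have : 0 < s - r := by linarith
      positivity

/-- An absolute constant in the gradient bound for cutoff functions. -/
def cutoffConst : ℝ := exists_cutoff.choose

theorem cutoffConst_pos : 0 < cutoffConst := exists_cutoff.choose_spec.1

theorem exists_cutoff_between_balls {n : ℕ} (y : EucSp n) {r s : ℝ} (hr : 0 < r) (hrs : r < s) :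
    ∃ χ : EucSp n → ℝ, IsTest (ball y s) χ ∧ (∀ x ∈ closedBall y r, χ x = 1) ∧
      (∀ x, |χ x| ≤ 1) ∧ ∀ x, ‖gradient χ x‖ ≤ cutoffConst / (s - r) :=
  exists_cutoff.choose_spec.2 y r s hr hrs

theorem memLp_sobVal {n : ℕ} {Ω : Set (EucSp n)} (ψ : W12 Ω) :
    MemLp (sobVal ψ) 2 (volume.restrict Ω) := Lp.memLp _

theorem memLp_sobGrad {n : ℕ} {Ω : Set (EucSp n)} (ψ : W12 Ω) :
    MemLp (sobGrad ψ) 2 (volume.restrict Ω) := Lp.memLp _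

theorem IsTest.continuous_gradient {n : ℕ} {Ω : Set (EucSp n)} {χ : EucSp n → ℝ}
    (hχ : IsTest Ω χ) : Continuous (gradient χ) :=
  gradient_continuous_of_contDiff (hχ.1.of_le (by simp))

theorem IsTest.exists_bound {n : ℕ} {Ω : Set (EucSp n)} {χ : EucSp n → ℝ}
    (hχ : IsTest Ω χ) : ∃ c : ℝ, 0 ≤ c ∧ (∀ x, |χ x| ≤ c) ∧ ∀ x, ‖gradient χ x‖ ≤ c := by
  obtain ⟨a, ha⟩ := hχ.2.1.exists_bound_of_continuous hχ.1.continuous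
  obtain ⟨b, hb⟩ := (hasCompactSupport_gradient hχ.2.1).exists_bound_of_continuous
    hχ.continuous_gradient
  exact ⟨max (max a b) 0, le_max_right _ _,
    fun x => (ha x).trans ((le_max_left _ _).trans (le_max_left _ _)),
    fun x => (hb x).trans ((le_max_right _ _).trans (le_max_left _ _))⟩

/-- The gradient `χ ∇ψ + ψ ∇χ` of the product of a test function and a Sobolev function. -/
def prodGrad {n : ℕ} {Ω : Set (EucSp n)} (χ : EucSp n → ℝ) (ψ : W12 Ω) (x : EucSp n) : EucSp n :=
  χ x • sobGrad ψ x + sobVal ψ x • gradient χ x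

theorem memLp_mul_sobVal {n : ℕ} {Ω : Set (EucSp n)} {χ : EucSp n → ℝ} (hχ : IsTest Ω χ)
    (ψ : W12 Ω) : MemLp (fun x => χ x * sobVal ψ x) 2 (volume.restrict Ω) := by
  obtain ⟨c, -, hc, -⟩ := hχ.exists_bound
  exact (memLp_sobVal ψ).of_le_mul (c := c)
    (hχ.1.continuous.aestronglyMeasurable.mul (memLp_sobVal ψ).1)
    (ae_of_all _ fun x => by
      rw [norm_mul]; exact mul_le_mul_of_nonneg_right (hc x) (norm_nonneg _))

theorem memLp_smul_sobGrad {n : ℕ} {Ω : Set (EucSp n)} {χ : EucSp n → ℝ} (hχ : IsTest Ω χ)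
    (ψ : W12 Ω) : MemLp (fun x => χ x • sobGrad ψ x) 2 (volume.restrict Ω) := by
  obtain ⟨c, -, hc, -⟩ := hχ.exists_bound
  exact (memLp_sobGrad ψ).of_le_mul (c := c)
    (hχ.1.continuous.aestronglyMeasurable.smul (memLp_sobGrad ψ).1)
    (ae_of_all _ fun x => by
      rw [norm_smul]; exact mul_le_mul_of_nonneg_right (hc x) (norm_nonneg _))

theorem memLp_smul_gradient {n : ℕ} {Ω : Set (EucSp n)} {χ : EucSp n → ℝ} (hχ : IsTest Ω χ)
    (ψ : W12 Ω) : MemLp (fun x => sobVal ψ x • gradient χ x) 2 (volume.restrict Ω) := by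
  obtain ⟨c, -, -, hc⟩ := hχ.exists_bound
  exact (memLp_sobVal ψ).of_le_mul (c := c)
    ((memLp_sobVal ψ).1.smul hχ.continuous_gradient.aestronglyMeasurable)
    (ae_of_all _ fun x => by
      rw [norm_smul, mul_comm]; exact mul_le_mul_of_nonneg_right (hc x) (norm_nonneg _))

theorem memLp_prodGrad {n : ℕ} {Ω : Set (EucSp n)} {χ : EucSp n → ℝ} (hχ : IsTest Ω χ)
    (ψ : W12 Ω) : MemLp (prodGrad χ ψ) 2 (volume.restrict Ω) :=
  (memLp_smul_sobGrad hχ ψ).add (memLp_smul_gradient hχ ψ)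

theorem gradient_mul {n : ℕ} {f g : EucSp n → ℝ} (hf : ContDiff ℝ (⊤ : ℕ∞) f)
    (hg : ContDiff ℝ (⊤ : ℕ∞) g) (x : EucSp n) :
    gradient (fun x => f x * g x) x = f x • gradient g x + g x • gradient f x := by
  have h1 := (hf.differentiable (by simp) x).hasFDerivAt
  have h2 := (hg.differentiable (by simp) x).hasFDerivAt
  refine HasGradientAt.gradient (hasGradientAt_iff_hasFDerivAt.2 ?_)
  refine HasFDerivAt.congr_fderiv (HasFDerivAt.fun_mul h1 h2) ?_
  simp

/-- The product rule for weak gradients. Since `χ` has compact support in `Ω`, the test function `η`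
need not be supported in `Ω`. -/
theorem integral_mul_smul_gradient_eq {n : ℕ} {Ω : Set (EucSp n)} {χ : EucSp n → ℝ}
    (hχ : IsTest Ω χ) (ψ : W12 Ω) {η : EucSp n → ℝ} (hη : IsTest univ η) :
    ∫ x in Ω, (χ x * sobVal ψ x) • gradient η x = - ∫ x in Ω, η x • prodGrad χ ψ x := by
  have hχη : IsTest Ω fun x => χ x * η x :=
    ⟨hχ.1.mul hη.1, hχ.2.1.mul_right, (tsupport_mul_subset_left).trans hχ.2.2⟩
  have h : ∫ x in Ω, sobVal ψ x • gradient (fun x => χ x * η x) x =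
      - ∫ x in Ω, (χ x * η x) • sobGrad ψ x := ψ.2 _ hχη
  have hη' : ∀ {F : Type} [NormedAddCommGroup F] [NormedSpace ℝ F] {g : EucSp n → F},
      MemLp g 2 (volume.restrict Ω) → Integrable (fun x => η x • g x) (volume.restrict Ω) := by
    intro F _ _ g hg
    have hm : MemLp η 2 (volume.restrict Ω) :=
      hη.1.continuous.memLp_of_hasCompactSupport hη.2.1
    exact memLp_one_iff_integrable.1 (hg.smul (p := 2) (q := 2) (r := 1) hm)
  have i1 : Integrable (fun x => (χ x * sobVal ψ x) • gradient η x) (volume.restrict Ω) := by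
    have hm : MemLp (gradient η) 2 (volume.restrict Ω) :=
      hη.continuous_gradient.memLp_of_hasCompactSupport (hasCompactSupport_gradient hη.2.1)
    exact memLp_one_iff_integrable.1 (hm.smul (q := 2) (r := 1) (memLp_mul_sobVal hχ ψ))
  have i2 := hη' (memLp_smul_gradient hχ ψ)
  have i3 := hη' (memLp_smul_sobGrad hχ ψ)
  have e1 : ∀ x, sobVal ψ x • gradient (fun x => χ x * η x) x =
      (χ x * sobVal ψ x) • gradient η x + η x • sobVal ψ x • gradient χ x := fun x => by
    rw [gradient_mul hχ.1 hη.1, smul_add, smul_smul, smul_smul, smul_smul, mul_comm (sobVal ψ x),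
      mul_comm (sobVal ψ x)]
  have e2 : ∀ x, (χ x * η x) • sobGrad ψ x = η x • χ x • sobGrad ψ x := fun x => by
    rw [smul_smul, mul_comm]
  simp_rw [e1, e2] at h
  rw [integral_add i1 i2] at h
  simp_rw [prodGrad, smul_add]
  rw [integral_add i3 i2, neg_add, ← h]
  abel

theorem isWeakGradient_mul {n : ℕ} {Ω : Set (EucSp n)} {χ : EucSp n → ℝ}
    (hχ : IsTest Ω χ) (ψ : W12 Ω) :
    IsWeakGradient univ (fun x => χ x * sobVal ψ x) (prodGrad χ ψ) := by
  intro η hη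
  have h0 : ∀ x, x ∉ Ω → χ x = 0 ∧ gradient χ x = 0 := fun x hx =>
    have hx' : x ∉ tsupport χ := fun h => hx (hχ.2.2 h)
    ⟨image_eq_zero_of_notMem_tsupport hx', gradient_eq_zero_of_notMem_tsupport hx'⟩
  have h := integral_mul_smul_gradient_eq hχ ψ hη
  rw [setIntegral_eq_integral_of_forall_compl_eq_zero fun x hx => by simp [h0 x hx],
    setIntegral_eq_integral_of_forall_compl_eq_zero fun x hx => by simp [prodGrad, h0 x hx]] at h
  simpa using h

/-- The product of a test function and a Sobolev function, as a Sobolev function. -/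
def mulW12 {n : ℕ} {Ω : Set (EucSp n)} {χ : EucSp n → ℝ} (hχ : IsTest Ω χ) (ψ : W12 Ω) : W12 Ω :=
  ⟨WithLp.toLp 2 ((memLp_mul_sobVal hχ ψ).toLp _, (memLp_prodGrad hχ ψ).toLp _), by
    intro η hη
    have h := integral_mul_smul_gradient_eq hχ ψ ⟨hη.1, hη.2.1, subset_univ _⟩
    have e1 := (memLp_mul_sobVal hχ ψ).coeFn_toLp
    have e2 := (memLp_prodGrad hχ ψ).coeFn_toLp
    refine Eq.trans ?_ (h.trans ?_)
    · refine integral_congr_ae ?_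
      filter_upwards [e1] with x hx
      exact congrArg (· • gradient η x) hx
    · refine congrArg Neg.neg (integral_congr_ae ?_)
      filter_upwards [e2] with x hx
      exact congrArg (η x • ·) hx.symm⟩

theorem sobVal_mulW12 {n : ℕ} {Ω : Set (EucSp n)} {χ : EucSp n → ℝ} (hχ : IsTest Ω χ)
    (ψ : W12 Ω) : sobVal (mulW12 hχ ψ) =ᵐ[volume.restrict Ω] fun x => χ x * sobVal ψ x :=
  (memLp_mul_sobVal hχ ψ).coeFn_toLp

theorem sobGrad_mulW12 {n : ℕ} {Ω : Set (EucSp n)} {χ : EucSp n → ℝ} (hχ : IsTest Ω χ)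
    (ψ : W12 Ω) : sobGrad (mulW12 hχ ψ) =ᵐ[volume.restrict Ω] prodGrad χ ψ :=
  (memLp_prodGrad hχ ψ).coeFn_toLp

/-! ### The multiplier inequality in terms of the Newton potential -/

theorem eLpNorm_two_sq {α F : Type*} [MeasurableSpace α] [NormedAddCommGroup F] (f : α → F)
    (μ : Measure α) : eLpNorm f 2 μ ^ 2 = ∫⁻ x, ‖f x‖ₑ ^ 2 ∂μ := by
  rw [eLpNorm_eq_lintegral_rpow_enorm_toReal (by norm_num) (by norm_num), ← ENNReal.rpow_natCast,
    ← ENNReal.rpow_mul]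
  norm_num

theorem lintegral_enorm_mul_enorm_le {α F G : Type*} [MeasurableSpace α] [NormedAddCommGroup F]
    [NormedAddCommGroup G] {μ : Measure α} {f : α → F} {g : α → G}
    (hf : AEStronglyMeasurable f μ) (hg : AEStronglyMeasurable g μ) :
    ∫⁻ x, ‖f x‖ₑ * ‖g x‖ₑ ∂μ ≤ eLpNorm f 2 μ * eLpNorm g 2 μ := by
  rw [eLpNorm_eq_lintegral_rpow_enorm_toReal (by norm_num) (by norm_num),
    eLpNorm_eq_lintegral_rpow_enorm_toReal (by norm_num) (by norm_num)]
  simpa using ENNReal.lintegral_mul_le_Lp_mul_Lq μ Real.HolderConjugate.two_two hf.enorm hg.enorm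

theorem eLpNorm_restrict_eq_of_ae_zero {α F : Type*} [MeasurableSpace α] [NormedAddCommGroup F]
    {μ : Measure α} {A B : Set α} (hA : MeasurableSet A) (hAB : A ⊆ B) {f : α → F}
    (h : ∀ᵐ x ∂(μ.restrict B), x ∉ A → f x = 0) (p : ℝ≥0∞) :
    eLpNorm f p (μ.restrict B) = eLpNorm f p (μ.restrict A) := by
  have h1 : f =ᵐ[μ.restrict B] A.indicator f := by
    filter_upwards [h] with x hx
    by_cases hxA : x ∈ A
    · rw [indicator_of_mem hxA]
    · rw [indicator_of_notMem hxA, hx hxA]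
  rw [eLpNorm_congr_ae h1, eLpNorm_indicator_eq_eLpNorm_restrict hA,
    Measure.restrict_restrict_of_subset hAB]

/-- The measure `|Γ|² dx` on `A`. -/
def fieldMeasure {n : ℕ} (Γ : EucSp n → EucSp n) (A : Set (EucSp n)) : Measure (EucSp n) :=
  (volume.restrict A).withDensity fun x => ‖Γ x‖ₑ ^ 2

theorem fieldMeasure_univ {n : ℕ} (Γ : EucSp n → EucSp n) (A : Set (EucSp n)) :
    fieldMeasure Γ A univ = ∫⁻ x in A, ‖Γ x‖ₑ ^ 2 := by
  rw [fieldMeasure, withDensity_apply _ MeasurableSet.univ, Measure.restrict_univ]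

theorem isFiniteMeasure_fieldMeasure {n : ℕ} {Γ : EucSp n → EucSp n} {A : Set (EucSp n)}
    (hΓ : MemLp Γ 2 (volume.restrict A)) : IsFiniteMeasure (fieldMeasure Γ A) := by
  refine ⟨?_⟩
  rw [fieldMeasure_univ, ← eLpNorm_two_sq]
  exact ENNReal.pow_lt_top hΓ.2

theorem fieldMeasure_absolutelyContinuous {n : ℕ} (Γ : EucSp n → EucSp n) (A : Set (EucSp n)) :
    fieldMeasure Γ A ≪ volume :=
  (withDensity_absolutelyContinuous _ _).trans Measure.absolutelyContinuous_restrict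

/-- The trace inequality for a Sobolev function cut off by a test function. -/
theorem eLpNorm_norm_mul_le {n : ℕ} (hn : 3 ≤ n) {Ω : Set (EucSp n)} (hΩ : IsOpen Ω)
    {Γ : EucSp n → EucSp n} {A : Set (EucSp n)}
    (hΓ : MemLp Γ 2 (volume.restrict A)) {M : ℝ} (hM0 : 0 ≤ M)
    (hM : ∀ ε : ℝ, 0 < ε → ∀ x ∈ Ω, newtonPotential (fieldMeasure Γ A) ε x ≤ M)
    {χ : EucSp n → ℝ} (hχ : IsTest Ω χ) (ψ : W12 Ω) :
    eLpNorm (fun x => ‖Γ x‖ * (χ x * sobVal ψ x)) 2 (volume.restrict A) ≤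
      ENNReal.ofReal √(M / traceConst n) * eLpNorm (prodGrad χ ψ) 2 (volume.restrict Ω) := by
  have := isFiniteMeasure_fieldMeasure hΓ
  have h0 : ∀ x, x ∉ Ω → χ x = 0 ∧ gradient χ x = 0 := fun x hx =>
    have hx' : x ∉ tsupport χ := fun h => hx (hχ.2.2 h)
    ⟨image_eq_zero_of_notMem_tsupport hx', gradient_eq_zero_of_notMem_tsupport hx'⟩
  have i1 : Ω.indicator (fun x => χ x * sobVal ψ x) = fun x => χ x * sobVal ψ x :=
    indicator_eq_self.2 fun x hx => by
      by_contra h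
      exact hx (by simp [h0 x h])
  have i2 : Ω.indicator (prodGrad χ ψ) = prodGrad χ ψ :=
    indicator_eq_self.2 fun x hx => by
      by_contra h
      exact hx (by simp [prodGrad, h0 x h])
  have m1 : MemLp (fun x => χ x * sobVal ψ x) 2 := by
    rw [← i1, memLp_indicator_iff_restrict hΩ.measurableSet]
    exact memLp_mul_sobVal hχ ψ
  have m2 : MemLp (prodGrad χ ψ) 2 := by
    rw [← i2, memLp_indicator_iff_restrict hΩ.measurableSet]
    exact memLp_prodGrad hχ ψ
  have e2 : eLpNorm (prodGrad χ ψ) 2 (volume.restrict Ω) = eLpNorm (prodGrad χ ψ) 2 volume := by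
    rw [← eLpNorm_indicator_eq_eLpNorm_restrict hΩ.measurableSet, i2]
  have h := traceConst_mul_lintegral_sq_le hn (fieldMeasure_absolutelyContinuous Γ A) hΩ
    hχ.2.1 hχ.2.2 hM0 hM m1 m2
    (fun x hx => subset_tsupport _ fun h => hx (by simp [h])) (isWeakGradient_mul hχ ψ)
  have e3 : ∫⁻ x, ‖χ x * sobVal ψ x‖ₑ ^ 2 ∂(fieldMeasure Γ A) =
      eLpNorm (fun x => ‖Γ x‖ * (χ x * sobVal ψ x)) 2 (volume.restrict A) ^ 2 := by
    rw [eLpNorm_two_sq, fieldMeasure, lintegral_withDensity_eq_lintegral_mul₀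
      (hΓ.1.enorm.pow_const 2) ((m1.1.mono_measure Measure.restrict_le_self).enorm.pow_const 2)]
    refine lintegral_congr fun x => ?_
    simp only [Pi.mul_apply, enorm_mul ‖Γ x‖, enorm_norm, mul_pow]
  rw [e3, ← eLpNorm_two_sq, ← e2] at h
  have hc := traceConst_pos hn
  rw [← ENNReal.pow_le_pow_left_iff two_ne_zero]
  rw [mul_pow, ← ENNReal.ofReal_pow (Real.sqrt_nonneg _), Real.sq_sqrt (by positivity),
    ENNReal.ofReal_div_of_pos hc, ENNReal.mul_div_right_comm.symm]
  rw [ENNReal.le_div_iff_mul_le (Or.inl (by simpa using hc)) (Or.inl ENNReal.ofReal_ne_top),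
    mul_comm]
  exact h

/-- A Sobolev function supported in a closed ball vanishes almost everywhere off the open ball,
and so does its weak gradient. -/
theorem ae_eq_zero_of_supportedInBall {n : ℕ} {Ω : Set (EucSp n)} (hΩ : IsOpen Ω)
    (hfin : volume Ω ≠ ∞) {φ : W12 Ω} {y : EucSp n} {r : ℝ} (hr : 0 < r)
    (hφ : SupportedInBall φ y r) :
    ∀ᵐ x ∂(volume.restrict Ω), x ∉ ball y r → sobVal φ x = 0 ∧ sobGrad φ x = 0 := by
  have : IsFiniteMeasure (volume.restrict Ω) := ⟨by simpa using hfin.lt_top⟩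
  have hint : IntegrableOn (sobGrad φ) Ω := (memLp_sobGrad φ).integrable (by norm_num)
  have hU : IsOpen (Ω \ closedBall y r) := hΩ.sdiff isClosed_closedBall
  have hg := hU.ae_eq_zero_of_integral_contDiff_smul_eq_zero
    (hint.mono_set sdiff_subset).locallyIntegrableOn (fun g hg hgs hgt => by
      have hT : IsTest Ω g := ⟨hg, hgs, hgt.trans sdiff_subset⟩
      have h : ∫ x in Ω, sobVal φ x • gradient g x = - ∫ x in Ω, g x • sobGrad φ x := φ.2 g hT
      rw [← setIntegral_eq_integral_of_forall_compl_eq_zero (s := Ω) fun x hx => by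
        rw [image_eq_zero_of_notMem_tsupport fun h => hx (hT.2.2 h), zero_smul],
        ← neg_eq_zero, ← h]
      refine integral_eq_zero_of_ae ?_
      filter_upwards [hφ] with x hx
      by_cases hxb : x ∈ closedBall y r
      · rw [gradient_eq_zero_of_notMem_tsupport fun h => (hgt h).2 hxb]
        simp
      · simp [hx hxb])
  have hs : ∀ᵐ x : EucSp n, x ∉ sphere y r :=
    measure_eq_zero_iff_ae_notMem.1 (Measure.addHaar_sphere_of_ne_zero _ y hr.ne')
  filter_upwards [hφ, ae_restrict_of_ae hg, ae_restrict_of_ae hs,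
    ae_restrict_mem hΩ.measurableSet] with x h1 h2 h3 h4 h5
  have h6 : x ∉ closedBall y r := fun h => by
    rw [← ball_union_sphere] at h
    exact h.elim h5 h3
  exact ⟨h1 h6, h2 ⟨h4, h6⟩⟩

/-- The multiplier inequality, given a bound for the Newton potential of `|Γ|²` on the ball
supporting `φ`. -/
theorem integrableOn_divIntegrand_and_abs_divForm_le {n : ℕ} (hn : 3 ≤ n) {Ω : Set (EucSp n)}
    (hΩ : IsOpen Ω) (hfin : volume Ω ≠ ∞) {Γ : EucSp n → EucSp n}
    (hΓ : MemLp Γ 2 (volume.restrict Ω)) {y : EucSp n} {r s : ℝ} (hr : 0 < r) (hrs : r < s)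
    (hsΩ : ball y s ⊆ Ω) {M : ℝ} (hM0 : 0 ≤ M)
    (hM : ∀ ε : ℝ, 0 < ε → ∀ x ∈ Ω, newtonPotential (fieldMeasure Γ (ball y r)) ε x ≤ M)
    (ψ φ : W12 Ω) (hφ : SupportedInBall φ y r) :
    IntegrableOn (divIntegrand Γ ψ φ) Ω ∧
      |divForm Γ ψ φ| ≤ (cutoffConst + 2) * √(M / traceConst n) * normL12 ψ y r s *
        lpNorm (sobGrad φ) 2 (volume.restrict (ball y r)) := by
  have hB0 := cutoffConst_pos
  obtain ⟨χ, hχ, hχ1, hχb, hχg⟩ := exists_cutoff_between_balls y hr hrs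
  set B := cutoffConst with hB
  have hsr : 0 < s - r := by linarith
  have hAs : ball y r ⊆ ball y s := ball_subset_ball hrs.le
  have hA : ball y r ⊆ Ω := hAs.trans hsΩ
  have hχΩ : IsTest Ω χ := ⟨hχ.1, hχ.2.1, hχ.2.2.trans hsΩ⟩
  have hΓA : MemLp Γ 2 (volume.restrict (ball y r)) := hΓ.mono_measure (Measure.restrict_mono hA le_rfl)
  have hz := ae_eq_zero_of_supportedInBall hΩ hfin hr hφ
  have hχA : ∀ x ∈ ball y r, χ x = 1 ∧ gradient χ x = 0 := fun x hx =>
    ⟨hχ1 x (ball_subset_closedBall hx), gradient_eq_zero_of_eventuallyEq_const (c := 1) (by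
      filter_upwards [isOpen_ball.mem_nhds hx] with z hzb using hχ1 z (ball_subset_closedBall hzb))⟩
  set σ := ENNReal.ofReal √(M / traceConst n) with hσ
  have hmono : volume.restrict (ball y r) ≤ volume.restrict Ω := Measure.restrict_mono hA le_rfl
  have hmonos : volume.restrict (ball y s) ≤ volume.restrict Ω := Measure.restrict_mono hsΩ le_rfl
  have hcut : ∀ u : W12 Ω, eLpNorm (fun x => ‖Γ x‖ * sobVal u x) 2 (volume.restrict (ball y r)) =
      eLpNorm (fun x => ‖Γ x‖ * (χ x * sobVal u x)) 2 (volume.restrict (ball y r)) := by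
    intro u
    refine eLpNorm_congr_ae ?_
    filter_upwards [ae_restrict_mem measurableSet_ball] with x hx
    rw [(hχA x hx).1, one_mul]
  -- Trace inequality for `φ = χφ`.
  have t1 : eLpNorm (fun x => ‖Γ x‖ * sobVal φ x) 2 (volume.restrict (ball y r)) ≤
      σ * eLpNorm (sobGrad φ) 2 (volume.restrict (ball y r)) := by
    rw [hcut φ]
    refine (eLpNorm_norm_mul_le hn hΩ hΓA hM0 hM hχΩ φ).trans (le_of_eq ?_)
    congr 1
    rw [← eLpNorm_restrict_eq_of_ae_zero measurableSet_ball hA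
      (hz.mono fun x hx h => (hx h).2) 2]
    refine eLpNorm_congr_ae ?_
    filter_upwards [hz] with x hx
    by_cases h : x ∈ ball y r
    · simp [prodGrad, hχA x h]
    · simp [prodGrad, hx h]
  -- Trace inequality for `χψ`, which agrees with `ψ` on the ball of radius `r`.
  have t2 : eLpNorm (fun x => ‖Γ x‖ * sobVal ψ x) 2 (volume.restrict (ball y r)) ≤
      σ * (eLpNorm (sobGrad ψ) 2 (volume.restrict (ball y s)) +
        ENNReal.ofReal (B / (s - r)) * eLpNorm (sobVal ψ) 2 (volume.restrict (ball y s))) := by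
    rw [hcut ψ]
    refine (eLpNorm_norm_mul_le hn hΩ hΓA hM0 hM hχΩ ψ).trans (mul_le_mul_right ?_ _)
    rw [eLpNorm_restrict_eq_of_ae_zero measurableSet_ball hsΩ (ae_of_all _ fun x hx => by
      have hx' : x ∉ tsupport χ := fun h => hx (hχ.2.2 h)
      simp [prodGrad, image_eq_zero_of_notMem_tsupport hx',
        gradient_eq_zero_of_notMem_tsupport hx']) 2]
    refine (eLpNorm_add_le ((memLp_smul_sobGrad hχΩ ψ).1.mono_measure hmonos)
      ((memLp_smul_gradient hχΩ ψ).1.mono_measure hmonos) (by norm_num)).trans (add_le_add ?_ ?_)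
    · refine eLpNorm_mono fun x => ?_
      rw [norm_smul]
      exact mul_le_of_le_one_left (norm_nonneg _) (hχb x)
    · refine eLpNorm_le_mul_eLpNorm_of_ae_le_mul (ae_of_all _ fun x => ?_) 2
      rw [norm_smul, mul_comm]
      exact mul_le_mul_of_nonneg_right (hχg x) (norm_nonneg _)
  have mψ := (memLp_sobVal ψ).mono_measure hmonos
  have mgψ := (memLp_sobGrad ψ).mono_measure hmonos
  have mgφ := (memLp_sobGrad φ).mono_measure hmono
  have hp0 : 0 ≤ lpNorm (sobGrad ψ) 2 (volume.restrict (ball y s)) := lpNorm_nonneg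
  have hv0 : 0 ≤ lpNorm (sobVal ψ) 2 (volume.restrict (ball y s)) := lpNorm_nonneg
  have hq0 : 0 ≤ lpNorm (sobGrad φ) 2 (volume.restrict (ball y r)) := lpNorm_nonneg
  have hmeas : AEStronglyMeasurable (divIntegrand Γ ψ φ) (volume.restrict Ω) :=
    hΓ.1.inner (((memLp_sobVal φ).1.smul (memLp_sobGrad ψ).1).add
      ((memLp_sobVal ψ).1.smul (memLp_sobGrad φ).1))
  have hL : ∫⁻ x in Ω, ‖divIntegrand Γ ψ φ x‖ₑ ≤ ENNReal.ofReal ((B + 2) * √(M / traceConst n) *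
      normL12 ψ y r s * lpNorm (sobGrad φ) 2 (volume.restrict (ball y r))) := by
    rw [← eLpNorm_one_eq_lintegral_enorm, eLpNorm_restrict_eq_of_ae_zero measurableSet_ball hA
      (hz.mono fun x hx h => by simp [divIntegrand, hx h]) 1, eLpNorm_one_eq_lintegral_enorm]
    calc ∫⁻ x in ball y r, ‖divIntegrand Γ ψ φ x‖ₑ
        ≤ ∫⁻ x in ball y r, (‖‖Γ x‖ * sobVal φ x‖ₑ * ‖sobGrad ψ x‖ₑ +
          ‖‖Γ x‖ * sobVal ψ x‖ₑ * ‖sobGrad φ x‖ₑ) := by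
          refine lintegral_mono fun x => ?_
          rw [divIntegrand, inner_add_right]
          refine (enorm_add_le _ _).trans (add_le_add ?_ ?_)
          all_goals
            rw [inner_smul_right, enorm_mul, enorm_mul, enorm_norm, mul_comm ‖Γ x‖ₑ, mul_assoc]
            gcongr
            rw [← enorm_norm (Γ x), ← enorm_norm (sobGrad _ x), ← enorm_mul]
            refine enorm_le_iff_norm_le.2 ?_
            rw [norm_mul, norm_norm, norm_norm]
            exact norm_inner_le_norm _ _
      _ ≤ eLpNorm (fun x => ‖Γ x‖ * sobVal φ x) 2 (volume.restrict (ball y r)) *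
            eLpNorm (sobGrad ψ) 2 (volume.restrict (ball y r)) +
          eLpNorm (fun x => ‖Γ x‖ * sobVal ψ x) 2 (volume.restrict (ball y r)) *
            eLpNorm (sobGrad φ) 2 (volume.restrict (ball y r)) := by
          have m1 : AEStronglyMeasurable (fun x => ‖Γ x‖ * sobVal φ x)
              (volume.restrict (ball y r)) :=
            hΓA.1.norm.mul ((memLp_sobVal φ).1.mono_measure hmono)
          have m2 : AEStronglyMeasurable (fun x => ‖Γ x‖ * sobVal ψ x)
              (volume.restrict (ball y r)) :=
            hΓA.1.norm.mul ((memLp_sobVal ψ).1.mono_measure hmono)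
          have m3 := (memLp_sobGrad ψ).1.mono_measure hmono
          rw [lintegral_add_left' (m1.enorm.fun_mul m3.enorm)]
          exact add_le_add (lintegral_enorm_mul_enorm_le m1 m3)
            (lintegral_enorm_mul_enorm_le m2 mgφ.1)
      _ ≤ σ * eLpNorm (sobGrad φ) 2 (volume.restrict (ball y r)) *
            eLpNorm (sobGrad ψ) 2 (volume.restrict (ball y s)) +
          σ * (eLpNorm (sobGrad ψ) 2 (volume.restrict (ball y s)) +
            ENNReal.ofReal (B / (s - r)) * eLpNorm (sobVal ψ) 2 (volume.restrict (ball y s))) *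
            eLpNorm (sobGrad φ) 2 (volume.restrict (ball y r)) := by
          gcongr
      _ ≤ _ := by
          rw [← ofReal_lpNorm mψ, ← ofReal_lpNorm mgψ, ← ofReal_lpNorm mgφ, hσ,
            ← ENNReal.ofReal_mul (by positivity), ← ENNReal.ofReal_mul (by positivity),
            ← ENNReal.ofReal_mul (by positivity),
            ← ENNReal.ofReal_add (by positivity) (by positivity),
            ← ENNReal.ofReal_mul (by positivity), ← ENNReal.ofReal_mul (by positivity),
            ← ENNReal.ofReal_add (by positivity) (by positivity)]
          refine ENNReal.ofReal_le_ofReal ?_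
          rw [normL12]
          set p := lpNorm (sobGrad ψ) 2 (volume.restrict (ball y s))
          set v := lpNorm (sobVal ψ) 2 (volume.restrict (ball y s))
          set q := lpNorm (sobGrad φ) 2 (volume.restrict (ball y r))
          set S := √(M / traceConst n)
          have hp : 0 ≤ S * q * (B * p + 2 * (v / (s - r))) := by positivity
          calc _ = (B + 2) * S * (v / (s - r) + p) * q - S * q * (B * p + 2 * (v / (s - r))) := by
                ring
            _ ≤ _ := by linarith
  refine ⟨⟨hmeas, hL.trans_lt ENNReal.ofReal_lt_top⟩, ?_⟩
  have hN : 0 ≤ normL12 ψ y r s := by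
    unfold normL12
    positivity
  rw [divForm, abs_neg, ← ENNReal.ofReal_le_ofReal_iff (by positivity),
    ← Real.enorm_eq_ofReal_abs]
  exact (enorm_integral_le_lintegral_enorm _).trans hL

/-! ### The square Dini integral -/

theorem IsModulus.nonneg {ω₁ : ℝ → ℝ} (hω : IsModulus ω₁) {r : ℝ} (h0 : 0 ≤ r) (h1 : r ≤ 1) :
    0 ≤ ω₁ r := by
  rw [← hω.zero]
  exact hω.mono ⟨le_rfl, zero_le_one⟩ ⟨h0, h1⟩ h0

theorem IsModulus.integrableOn_Ioc_one {ω₁ : ℝ → ℝ} (hω : IsModulus ω₁) {r₀ : ℝ} (h0 : 0 < r₀)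
    (h1 : r₀ ≤ 1) (h : IntegrableOn (fun r => ω₁ r ^ 2 / r) (Ioc 0 r₀)) :
    IntegrableOn (fun r => ω₁ r ^ 2 / r) (Ioc 0 1) := by
  rw [← Ioc_union_Ioc_eq_Ioc h0.le h1]
  refine h.union (IntegrableOn.mono_set (t := Icc r₀ 1) ?_ Ioc_subset_Icc_self)
  refine ContinuousOn.integrableOn_Icc ?_
  refine ((hω.cont.mono (Icc_subset_Icc h0.le le_rfl)).pow 2).div continuousOn_id ?_
  intro x hx
  exact (h0.trans_le hx.1).ne'

theorem intervalIntegrable_of_integrableOn_Ioc_one {f : ℝ → ℝ} (hf : IntegrableOn f (Ioc 0 1))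
    {r : ℝ} (h0 : 0 ≤ r) (h1 : r ≤ 1) : IntervalIntegrable f volume 0 r :=
  (intervalIntegrable_iff_integrableOn_Ioc_of_le h0).2
    (hf.mono_set (Ioc_subset_Ioc_right h1))

theorem sqrtDini_nonneg (ω₁ : ℝ → ℝ) (r : ℝ) : 0 ≤ sqrtDini ω₁ r := Real.sqrt_nonneg _

theorem sqrtDini_sq (ω₁ : ℝ → ℝ) {r : ℝ} (hr : 0 ≤ r) :
    sqrtDini ω₁ r ^ 2 = ∫ s in (0 : ℝ)..r, ω₁ s ^ 2 / s :=
  Real.sq_sqrt (intervalIntegral.integral_nonneg hr fun s hs => by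
    have := hs.1
    positivity)

theorem sqrtDini_mono {ω₁ : ℝ → ℝ} (hi : IntegrableOn (fun r => ω₁ r ^ 2 / r) (Ioc 0 1)) {r s : ℝ}
    (h0 : 0 ≤ r) (hrs : r ≤ s) (h1 : s ≤ 1) : sqrtDini ω₁ r ≤ sqrtDini ω₁ s := by
  refine Real.sqrt_le_sqrt ?_
  refine intervalIntegral.integral_mono_interval le_rfl h0 hrs ?_
    (intervalIntegrable_of_integrableOn_Ioc_one hi (h0.trans hrs) h1)
  filter_upwards [ae_restrict_mem measurableSet_Ioc] with t ht
  have := ht.1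
  simp only [Pi.zero_apply]
  positivity

theorem integral_sq_div_eq_comp_mul {ω₁ : ℝ → ℝ} {a : ℝ} (ha : 0 < a) :
    ∫ s in (0 : ℝ)..a, ω₁ s ^ 2 / s = ∫ t in (0 : ℝ)..1, ω₁ (a * t) ^ 2 / t := by
  have h := intervalIntegral.integral_comp_mul_left (a := 0) (b := 1)
    (fun s => ω₁ s ^ 2 / s) ha.ne'
  rw [mul_zero, mul_one, smul_eq_mul, eq_inv_mul_iff_mul_eq₀ ha.ne',
    ← intervalIntegral.integral_const_mul] at h
  rw [← h]
  refine intervalIntegral.integral_congr fun t _ => ?_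
  field_simp

theorem intervalIntegrable_sq_div_comp_mul {ω₁ : ℝ → ℝ}
    (hi : IntegrableOn (fun r => ω₁ r ^ 2 / r) (Ioc 0 1)) {a : ℝ} (ha : 0 < a) (ha1 : a ≤ 1) :
    IntervalIntegrable (fun t => ω₁ (a * t) ^ 2 / t) volume 0 1 := by
  have h := (intervalIntegrable_of_integrableOn_Ioc_one hi ha.le ha1).comp_mul_left (c := a)
  rw [zero_div, div_self ha.ne'] at h
  refine (h.const_mul a).congr fun t _ => ?_
  field_simp

/-- The triangle inequality in `L²(dt/t)` for `t ↦ ω₁ (a t)` and `t ↦ ω₁ (b t)`. -/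
theorem sqrtDini_subadd {ω₁ : ℝ → ℝ} (hω : IsModulus ω₁)
    (hi : IntegrableOn (fun r => ω₁ r ^ 2 / r) (Ioc 0 1)) {a b : ℝ} (ha : 0 ≤ a) (hb : 0 ≤ b)
    (hab : a + b ≤ 1) : sqrtDini ω₁ (a + b) ≤ sqrtDini ω₁ a + sqrtDini ω₁ b := by
  rcases ha.eq_or_lt with rfl | ha
  · simp [sqrtDini_nonneg]
  rcases hb.eq_or_lt with rfl | hb
  · simp [sqrtDini_nonneg]
  -- The weighted inequality `(u + v)² ≤ (P + Q) (u² / P + v² / Q)` is optimal for the norms `P`, `Q`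
  -- of the two functions; these may vanish, hence the `δ`.
  refine le_of_forall_pos_le_add fun δ hδ => ?_
  set p := sqrtDini ω₁ a
  set q := sqrtDini ω₁ b
  have hp : 0 ≤ p := sqrtDini_nonneg _ _
  have hq : 0 ≤ q := sqrtDini_nonneg _ _
  set P := p + δ / 2 with hP
  set Q := q + δ / 2 with hQ
  have hP0 : 0 < P := by positivity
  have hQ0 : 0 < Q := by positivity
  have ia := intervalIntegrable_sq_div_comp_mul hi ha (by linarith)
  have ib := intervalIntegrable_sq_div_comp_mul hi hb (by linarith)
  have ic := intervalIntegrable_sq_div_comp_mul hi (add_pos ha hb) hab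
  have key : ∫ s in (0 : ℝ)..(a + b), ω₁ s ^ 2 / s ≤
      (P + Q) / P * (∫ s in (0 : ℝ)..a, ω₁ s ^ 2 / s) +
        (P + Q) / Q * (∫ s in (0 : ℝ)..b, ω₁ s ^ 2 / s) := by
    rw [integral_sq_div_eq_comp_mul (add_pos ha hb), integral_sq_div_eq_comp_mul ha,
      integral_sq_div_eq_comp_mul hb, ← intervalIntegral.integral_const_mul,
      ← intervalIntegral.integral_const_mul,
      ← intervalIntegral.integral_add (ia.const_mul _) (ib.const_mul _)]
    refine intervalIntegral.integral_mono_on zero_le_one ic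
      ((ia.const_mul _).add (ib.const_mul _)) fun t ht => ?_
    have hat : 0 ≤ a * t := mul_nonneg ha.le ht.1
    have hbt : 0 ≤ b * t := mul_nonneg hb.le ht.1
    have hct : a * t + b * t ≤ 1 := by nlinarith [ht.1, ht.2]
    have h1 := hω.subadd _ _ hat hbt hct
    rw [← add_mul] at h1
    have h2 : 0 ≤ ω₁ ((a + b) * t) := hω.nonneg (by linarith) (by linarith)
    have h3 : ω₁ ((a + b) * t) ^ 2 ≤
        (P + Q) / P * ω₁ (a * t) ^ 2 + (P + Q) / Q * ω₁ (b * t) ^ 2 := by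
      refine (pow_le_pow_left₀ h2 h1 2).trans (sub_nonneg.1 ?_)
      have : (P + Q) / P * ω₁ (a * t) ^ 2 + (P + Q) / Q * ω₁ (b * t) ^ 2 -
          (ω₁ (a * t) + ω₁ (b * t)) ^ 2 = (Q * ω₁ (a * t) - P * ω₁ (b * t)) ^ 2 / (P * Q) := by
        field_simp
        ring
      rw [this]
      positivity
    rw [← mul_div_assoc, ← mul_div_assoc, ← add_div]
    exact div_le_div_of_nonneg_right h3 ht.1
  rw [← sqrtDini_sq ω₁ (by positivity), ← sqrtDini_sq ω₁ ha.le, ← sqrtDini_sq ω₁ hb.le] at key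
  have h4 : (P + Q) / P * p ^ 2 ≤ (P + Q) * P := by
    rw [div_mul_eq_mul_div, div_le_iff₀ hP0, mul_assoc]
    refine mul_le_mul_of_nonneg_left ?_ (by positivity)
    nlinarith
  have h5 : (P + Q) / Q * q ^ 2 ≤ (P + Q) * Q := by
    rw [div_mul_eq_mul_div, div_le_iff₀ hQ0, mul_assoc]
    refine mul_le_mul_of_nonneg_left ?_ (by positivity)
    nlinarith
  have h6 : sqrtDini ω₁ (a + b) ≤ P + Q :=
    le_of_sq_le_sq (by nlinarith) (by positivity)
  linarith

theorem isDiniModulus_sqrtDini {ω₁ : ℝ → ℝ} (hω : IsModulus ω₁) {r₀ : ℝ} (h0 : 0 < r₀)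
    (h1 : r₀ ≤ 1) (h : IntegrableOn (fun r => ω₁ r ^ 2 / r) (Ioc 0 r₀))
    (hD : IntegrableOn (fun r => 1 / r * √(∫ s in (0 : ℝ)..r, ω₁ s ^ 2 / s)) (Ioc 0 r₀)) :
    IsDiniModulus (sqrtDini ω₁) := by
  have hi := hω.integrableOn_Ioc_one h0 h1 h
  have hc : ContinuousOn (sqrtDini ω₁) (Icc 0 1) := by
    refine Real.continuous_sqrt.comp_continuousOn ?_
    have := intervalIntegral.continuousOn_primitive_interval (μ := volume) (a := 0) (b := 1)
      (f := fun s => ω₁ s ^ 2 / s) (by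
        rw [uIcc_of_le zero_le_one, integrableOn_Icc_iff_integrableOn_Ioc]; exact hi)
    rwa [uIcc_of_le zero_le_one] at this
  refine ⟨⟨by simp [sqrtDini], fun a ha b hb hab => sqrtDini_mono hi ha.1 hab hb.2, hc,
    fun a b ha hb hab => sqrtDini_subadd hω hi ha hb hab⟩, ?_⟩
  rw [← Ioc_union_Ioc_eq_Ioc h0.le h1]
  refine IntegrableOn.union ?_ (IntegrableOn.mono_set (t := Icc r₀ 1) ?_ Ioc_subset_Icc_self)
  · refine hD.congr_fun (fun r _ => ?_) measurableSet_Ioc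
    simp only [sqrtDini]
    ring
  · refine ContinuousOn.integrableOn_Icc ?_
    refine (hc.mono (Icc_subset_Icc h0.le le_rfl)).div continuousOn_id ?_
    intro x hx
    exact (h0.trans_le hx.1).ne'

/-- By subadditivity `ω₁ r ≤ 2 ω₁ (r / 2)`, and `ω₁ (r / 2) ≤ ω₁ s` for `r / 2 ≤ s ≤ r`. -/
theorem sq_le_mul_sqrtDini_sq {ω₁ : ℝ → ℝ} (hω : IsModulus ω₁)
    (hi : IntegrableOn (fun r => ω₁ r ^ 2 / r) (Ioc 0 1)) {r : ℝ} (h0 : 0 < r) (h1 : r ≤ 1) :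
    ω₁ r ^ 2 ≤ 8 * sqrtDini ω₁ r ^ 2 := by
  have hh : 0 ≤ ω₁ (r / 2) := hω.nonneg (by positivity) (by linarith)
  have h2 : ω₁ r ≤ 2 * ω₁ (r / 2) := by
    have := hω.subadd (r / 2) (r / 2) (by positivity) (by positivity) (by linarith)
    rw [add_halves] at this
    linarith
  have hr := intervalIntegrable_of_integrableOn_Ioc_one hi h0.le h1
  have h3 : ω₁ (r / 2) ^ 2 / 2 ≤ ∫ s in (0 : ℝ)..r, ω₁ s ^ 2 / s := by
    calc ω₁ (r / 2) ^ 2 / 2 = ∫ s in (r / 2)..r, ω₁ (r / 2) ^ 2 / r := by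
          rw [intervalIntegral.integral_const, smul_eq_mul]
          field_simp
          ring
      _ ≤ ∫ s in (r / 2)..r, ω₁ s ^ 2 / s := by
          refine intervalIntegral.integral_mono_on (by linarith) intervalIntegrable_const
            (hr.mono_set ?_) fun s hs => ?_
          · rw [uIcc_of_le (by linarith), uIcc_of_le h0.le]
            exact Icc_subset_Icc (by linarith) le_rfl
          · have hs0 : 0 < s := by linarith [hs.1]
            have := hω.mono ⟨by positivity, by linarith⟩ ⟨hs0.le, by linarith [hs.2]⟩ hs.1
            gcongr
            exact hs.2
      _ ≤ _ := by
          refine intervalIntegral.integral_mono_interval (by positivity) (by linarith) le_rfl ?_ hr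
          filter_upwards [ae_restrict_mem measurableSet_Ioc] with t ht
          have := ht.1
          simp only [Pi.zero_apply]
          positivity
  rw [sqrtDini_sq ω₁ h0.le]
  have := hω.nonneg h0.le h1
  nlinarith

/-! ### The Newton potential of a field satisfying a Morrey bound -/

/-- The volume of the unit ball. -/
def unitBallVolume (n : ℕ) : ℝ := (volume (ball (0 : EucSp n) 1)).toReal

theorem unitBallVolume_pos (n : ℕ) : 0 < unitBallVolume n :=
  ENNReal.toReal_pos (measure_ball_pos _ _ one_pos).ne' measure_ball_lt_top.ne

/-- The Morrey bound for `|Γ|²` on balls, from the bounds for the means of the components. -/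
theorem lintegral_enorm_sq_ball_le {n : ℕ} (hn : 3 ≤ n) {Γ : EucSp n → EucSp n}
    (hΓ : MemLp Γ 2 (volume.restrict (unitBall n))) {C w r : ℝ} (hC : 0 ≤ C) (hw : 0 ≤ w)
    (hr : 0 < r) {y : EucSp n} (hy : y ∈ unitBall n)
    (h : ∀ i : Fin n, √(⨍ x in unitBall n ∩ ball y r, |Γ x i| ^ 2) ≤ C * (w / r)) :
    ∫⁻ x in unitBall n ∩ ball y r, ‖Γ x‖ₑ ^ 2 ≤
      ENNReal.ofReal (n * unitBallVolume n * C ^ 2 * (w ^ 2 * r ^ (n - 2))) := by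
  set S := unitBall n ∩ ball y r with hS
  have hΓS : MemLp Γ 2 (volume.restrict S) :=
    hΓ.mono_measure (Measure.restrict_mono inter_subset_left le_rfl)
  have hSo : IsOpen S := isOpen_ball.inter isOpen_ball
  have hS0 : 0 < volume.real S := by
    refine ENNReal.toReal_pos (hSo.measure_pos volume ⟨y, hy, mem_ball_self hr⟩).ne' ?_
    exact (measure_mono inter_subset_right).trans_lt measure_ball_lt_top |>.ne
  have hSr : volume.real S ≤ r ^ n * unitBallVolume n := by
    rw [unitBallVolume, ← volume_real_ball y hr]
    exact ENNReal.toReal_mono measure_ball_lt_top.ne (measure_mono inter_subset_right)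
  have hi : ∀ i : Fin n, Integrable (fun x => |Γ x i| ^ 2) (volume.restrict S) := fun i => by
    have h1 : MemLp (fun x => Γ x i) 2 (volume.restrict S) :=
      (EuclideanSpace.proj i : EucSp n →L[ℝ] ℝ).comp_memLp' hΓS
    simpa using h1.integrable_norm_pow (p := 2) (by norm_num)
  have hb : ∀ i : Fin n, ∫ x in S, |Γ x i| ^ 2 ≤ (C * (w / r)) ^ 2 * (r ^ n * unitBallVolume n) := by
    intro i
    have h1 := (Real.sqrt_le_left (by positivity)).1 (h i)
    rw [setAverage_eq, smul_eq_mul, inv_mul_le_iff₀ hS0] at h1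
    refine h1.trans ?_
    rw [mul_comm]
    gcongr
  have hsum : ∀ x, ‖Γ x‖ ^ 2 = ∑ i, |Γ x i| ^ 2 := fun x => by
    rw [EuclideanSpace.norm_sq_eq]; rfl
  have hint : ∫ x in S, ‖Γ x‖ ^ 2 ≤ n * unitBallVolume n * C ^ 2 * (w ^ 2 * r ^ (n - 2)) := by
    simp_rw [hsum]
    rw [integral_finsetSum _ fun i _ => hi i]
    refine (Finset.sum_le_sum fun i _ => hb i).trans (le_of_eq ?_)
    rw [Finset.sum_const, Finset.card_univ, Fintype.card_fin, nsmul_eq_mul]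
    obtain ⟨k, rfl⟩ : ∃ k, n = k + 2 := ⟨n - 2, by omega⟩
    rw [Nat.add_sub_cancel]
    field_simp
    ring
  calc _ = ENNReal.ofReal (∫ x in S, ‖Γ x‖ ^ 2) := by
        rw [ofReal_integral_eq_lintegral_ofReal (by
          simpa using hΓS.integrable_norm_pow (p := 2) (by norm_num))
          (ae_of_all _ fun x => sq_nonneg _)]
        refine lintegral_congr fun x => ?_
        rw [ENNReal.ofReal_pow (norm_nonneg _), ofReal_norm]
    _ ≤ _ := ENNReal.ofReal_le_ofReal hint

/-- The kernel `t^{2-n}`, dominated by an average of the indicators of the balls containing `t`. -/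
theorem inv_pow_le_lintegral {n : ℕ} (hn : 3 ≤ n) {t ρ : ℝ} (ht : 0 < t) (hρ : 0 < ρ) :
    ENNReal.ofReal (t ^ (n - 2))⁻¹ ≤
      ENNReal.ofReal (2 ^ (n - 1)) *
        (∫⁻ s in Ioc 0 ρ, (Ioi t).indicator (fun s => ENNReal.ofReal (s ^ (n - 1))⁻¹) s) +
      ENNReal.ofReal (2 ^ (n - 2) * (ρ ^ (n - 2))⁻¹) := by
  -- For `2 t < ρ` the part `t < s ≤ 2 t` of the integral suffices.
  rcases le_or_gt ρ (2 * t) with h | h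
  · refine le_add_left (ENNReal.ofReal_le_ofReal ?_)
    rw [← div_eq_mul_inv, le_div_iff₀ (by positivity), inv_mul_le_iff₀ (by positivity),
      mul_comm, ← mul_pow]
    gcongr
  · refine le_add_right ?_
    have hsub : Ioc t (2 * t) ⊆ Ioc 0 ρ ∩ Ioi t := fun s hs =>
      ⟨⟨ht.trans hs.1, hs.2.trans h.le⟩, hs.1⟩
    rw [lintegral_indicator measurableSet_Ioi, Measure.restrict_restrict measurableSet_Ioi,
      inter_comm]
    calc ENNReal.ofReal (t ^ (n - 2))⁻¹
        = ENNReal.ofReal (2 ^ (n - 1)) *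
          ∫⁻ s in Ioc t (2 * t), ENNReal.ofReal ((2 * t) ^ (n - 1))⁻¹ := by
          rw [setLIntegral_const, Real.volume_Ioc, ← ENNReal.ofReal_mul (by positivity),
            ← ENNReal.ofReal_mul (by positivity)]
          congr 1
          obtain ⟨k, rfl⟩ : ∃ k, n = k + 2 := ⟨n - 2, by omega⟩
          rw [Nat.add_sub_cancel, show k + 2 - 1 = k + 1 by omega, mul_pow]
          field_simp
          ring
      _ ≤ ENNReal.ofReal (2 ^ (n - 1)) *
          ∫⁻ s in Ioc t (2 * t), ENNReal.ofReal (s ^ (n - 1))⁻¹ := by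
          refine mul_le_mul_right (setLIntegral_mono (by fun_prop) fun s hs => ?_) _
          have : 0 < s := ht.trans hs.1
          refine ENNReal.ofReal_le_ofReal ?_
          gcongr
          exact hs.2
      _ ≤ _ := by gcongr

theorem newtonKernel_eq_inv_pow {n : ℕ} (hn : 3 ≤ n) {ε : ℝ} (hε : 0 < ε) (z : EucSp n) :
    newtonKernel n ε z = (√(‖z‖ ^ 2 + ε ^ 2) ^ (n - 2))⁻¹ := by
  have h : 0 < ‖z‖ ^ 2 + ε ^ 2 := by positivity
  rw [newtonKernel, Real.sqrt_eq_rpow, ← Real.rpow_natCast _ (n - 2), ← Real.rpow_mul h.le,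
    ← Real.rpow_neg h.le]
  congr 1
  rw [Nat.cast_sub (by omega)]
  push_cast
  ring

/-- The Newton potential of a measure in terms of its masses on balls. -/
theorem lintegral_newtonKernel_le {n : ℕ} (hn : 3 ≤ n) (ν : Measure (EucSp n))
    [IsFiniteMeasure ν] {ε ρ : ℝ} (hε : 0 < ε) (hρ : 0 < ρ) (x : EucSp n) :
    ∫⁻ y, ENNReal.ofReal (newtonKernel n ε (x - y)) ∂ν ≤
      ENNReal.ofReal (2 ^ (n - 1)) *
        (∫⁻ s in Ioc 0 ρ, ENNReal.ofReal (s ^ (n - 1))⁻¹ * ν (ball x s)) +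
      ENNReal.ofReal (2 ^ (n - 2) * (ρ ^ (n - 2))⁻¹) * ν univ := by
  set I : EucSp n × ℝ → ℝ≥0∞ := {p | ‖x - p.1‖ < p.2}.indicator
    (fun p => ENNReal.ofReal (p.2 ^ (n - 1))⁻¹) with hI
  have hImeas : Measurable I := by
    refine Measurable.indicator (by fun_prop) (measurableSet_lt (by fun_prop) (by fun_prop))
  calc ∫⁻ y, ENNReal.ofReal (newtonKernel n ε (x - y)) ∂ν
      ≤ ∫⁻ y, (ENNReal.ofReal (2 ^ (n - 1)) * (∫⁻ s in Ioc 0 ρ, I (y, s)) +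
        ENNReal.ofReal (2 ^ (n - 2) * (ρ ^ (n - 2))⁻¹)) ∂ν := by
        refine lintegral_mono fun y => ?_
        have ht : 0 < √(‖x - y‖ ^ 2 + ε ^ 2) := by positivity
        rw [newtonKernel_eq_inv_pow hn hε]
        refine (inv_pow_le_lintegral hn ht hρ).trans ?_
        gcongr with s
        simp only [indicator_apply, mem_Ioi, mem_ofPred_eq, hI]
        have hlt : ‖x - y‖ ≤ √(‖x - y‖ ^ 2 + ε ^ 2) :=
          Real.le_sqrt_of_sq_le (by nlinarith)
        split_ifs with h1 h2
        · exact le_rfl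
        · exact absurd (hlt.trans_lt h1) h2
        · exact zero_le
        · exact le_rfl
    _ = ENNReal.ofReal (2 ^ (n - 1)) * (∫⁻ s in Ioc 0 ρ, ∫⁻ y, I (y, s) ∂ν) +
        ENNReal.ofReal (2 ^ (n - 2) * (ρ ^ (n - 2))⁻¹) * ν univ := by
        rw [lintegral_add_right _ measurable_const, lintegral_const,
          lintegral_const_mul _ hImeas.lintegral_prod_right']
        congr 2
        exact lintegral_lintegral_swap hImeas.aemeasurable
    _ = _ := by
        congr 2
        refine lintegral_congr fun s => ?_
        have : (fun y => I (y, s)) = (ball x s).indicator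
            (fun _ => ENNReal.ofReal (s ^ (n - 1))⁻¹) := by
          ext y
          have hmem : y ∈ ball x s ↔ ‖x - y‖ < s := by rw [mem_ball, dist_comm, dist_eq_norm]
          by_cases hy : ‖x - y‖ < s
          · rw [indicator_of_mem (hmem.2 hy), hI, indicator_of_mem]
            rwa [mem_ofPred_eq]
          · rw [indicator_of_notMem (hmem.not.2 hy), hI, indicator_of_notMem]
            rwa [mem_ofPred_eq]
        rw [this, lintegral_indicator_const measurableSet_ball]

/-- The Newton potential of `|Γ|²` on `A`, in terms of the square Dini integral and of the total
mass. -/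
theorem newtonPotential_fieldMeasure_le {n : ℕ} (hn : 3 ≤ n) {Γ : EucSp n → EucSp n}
    (hΓ : MemLp Γ 2 (volume.restrict (unitBall n))) {ω₁ : ℝ → ℝ} (hω : IsModulus ω₁)
    (hi : IntegrableOn (fun r => ω₁ r ^ 2 / r) (Ioc 0 1)) {C r₀ : ℝ} (hC : 0 ≤ C) (hr₀ : r₀ ≤ 1)
    (h : ∀ (i : Fin n) (r : ℝ), 0 < r → r ≤ r₀ → ∀ y ∈ unitBall n,
      √(⨍ x in unitBall n ∩ ball y r, |Γ x i| ^ 2) ≤ C * (ω₁ r / r))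
    {A : Set (EucSp n)} (hA : A ⊆ unitBall n) {ρ : ℝ} (hρ : 0 < ρ)
    (hρ₀ : ρ ≤ r₀) {m : ℝ} (hm0 : 0 ≤ m) (hm : ∫⁻ x in A, ‖Γ x‖ₑ ^ 2 ≤ ENNReal.ofReal m)
    {ε : ℝ} (hε : 0 < ε) {x : EucSp n} (hx : x ∈ unitBall n) :
    newtonPotential (fieldMeasure Γ A) ε x ≤
      2 ^ (n - 1) * (n * unitBallVolume n * C ^ 2) * sqrtDini ω₁ ρ ^ 2 +
        2 ^ (n - 2) * (ρ ^ (n - 2))⁻¹ * m := by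
  have hV := unitBallVolume_pos n
  have hfin := isFiniteMeasure_fieldMeasure
    (hΓ.mono_measure (Measure.restrict_mono hA le_rfl))
  set D := n * unitBallVolume n * C ^ 2 with hD
  have hD0 : 0 ≤ D := by positivity
  have hball : ∀ s ∈ Ioc 0 ρ, ENNReal.ofReal (s ^ (n - 1))⁻¹ * fieldMeasure Γ A (ball x s) ≤
      ENNReal.ofReal (D * (ω₁ s ^ 2 / s)) := by
    intro s hs
    have h1 : fieldMeasure Γ A (ball x s) ≤ ENNReal.ofReal (D * (ω₁ s ^ 2 * s ^ (n - 2))) := by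
      refine le_trans ?_ (lintegral_enorm_sq_ball_le hn hΓ hC
        (hω.nonneg hs.1.le (hs.2.trans (hρ₀.trans hr₀))) hs.1 hx
        fun i => h i s hs.1 (hs.2.trans hρ₀) x hx)
      rw [fieldMeasure, withDensity_apply _ measurableSet_ball,
        Measure.restrict_restrict measurableSet_ball, inter_comm]
      exact lintegral_mono_set (inter_subset_inter_left _ hA)
    refine (mul_le_mul_right h1 _).trans (le_of_eq ?_)
    have hs0 := hs.1
    rw [← ENNReal.ofReal_mul (by positivity)]
    congr 1
    obtain ⟨k, rfl⟩ : ∃ k, n = k + 2 := ⟨n - 2, by omega⟩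
    rw [Nat.add_sub_cancel, show k + 2 - 1 = k + 1 by omega]
    field_simp
    ring
  have hint : ∫⁻ s in Ioc 0 ρ, ENNReal.ofReal (D * (ω₁ s ^ 2 / s)) =
      ENNReal.ofReal (D * sqrtDini ω₁ ρ ^ 2) := by
    rw [sqrtDini_sq ω₁ hρ.le, intervalIntegral.integral_of_le hρ.le, ← integral_const_mul,
      ofReal_integral_eq_lintegral_ofReal
        ((hi.mono_set (Ioc_subset_Ioc_right (hρ₀.trans hr₀))).const_mul D)]
    filter_upwards [ae_restrict_mem measurableSet_Ioc] with t ht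
    have := ht.1
    simp only [Pi.zero_apply]
    positivity
  rw [newtonPotential, integral_eq_lintegral_of_nonneg_ae
    (ae_of_all _ fun y => newtonKernel_nonneg _ _)
    ((continuous_newtonKernel hε).comp (by fun_prop)).aestronglyMeasurable]
  refine ENNReal.toReal_le_of_le_ofReal (by positivity) ?_
  refine (lintegral_newtonKernel_le hn _ hε hρ x).trans ?_
  rw [ENNReal.ofReal_add (by positivity) (by positivity), mul_assoc (2 ^ (n - 1) : ℝ),
    ENNReal.ofReal_mul (p := 2 ^ (n - 1)) (by positivity),
    ENNReal.ofReal_mul (q := m) (by positivity), ← hint]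
  refine add_le_add (mul_le_mul_right (setLIntegral_mono' measurableSet_Ioc hball) _)
    (mul_le_mul_right ?_ _)
  rw [fieldMeasure_univ]
  exact hm

/-! ### Operators given by a divergence on test functions -/

theorem W12.ext_ae {n : ℕ} {Ω : Set (EucSp n)} {p q : W12 Ω}
    (h1 : sobVal p =ᵐ[volume.restrict Ω] sobVal q)
    (h2 : sobGrad p =ᵐ[volume.restrict Ω] sobGrad q) : p = q := by
  refine Subtype.ext ((WithLp.ofLp_injective 2) (Prod.ext (Lp.ext h1) (Lp.ext h2)))

theorem sobVal_add {n : ℕ} {Ω : Set (EucSp n)} (p q : W12 Ω) :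
    sobVal (p + q) =ᵐ[volume.restrict Ω] fun x => sobVal p x + sobVal q x :=
  Lp.coeFn_add _ _

theorem sobGrad_add {n : ℕ} {Ω : Set (EucSp n)} (p q : W12 Ω) :
    sobGrad (p + q) =ᵐ[volume.restrict Ω] fun x => sobGrad p x + sobGrad q x :=
  Lp.coeFn_add _ _

theorem sobVal_sub {n : ℕ} {Ω : Set (EucSp n)} (p q : W12 Ω) :
    sobVal (p - q) =ᵐ[volume.restrict Ω] fun x => sobVal p x - sobVal q x :=
  Lp.coeFn_sub _ _

theorem sobGrad_sub {n : ℕ} {Ω : Set (EucSp n)} (p q : W12 Ω) :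
    sobGrad (p - q) =ᵐ[volume.restrict Ω] fun x => sobGrad p x - sobGrad q x :=
  Lp.coeFn_sub _ _

theorem sobVal_smul {n : ℕ} {Ω : Set (EucSp n)} (c : ℝ) (p : W12 Ω) :
    sobVal (c • p) =ᵐ[volume.restrict Ω] fun x => c * sobVal p x :=
  Lp.coeFn_smul _ _

theorem sobGrad_smul {n : ℕ} {Ω : Set (EucSp n)} (c : ℝ) (p : W12 Ω) :
    sobGrad (c • p) =ᵐ[volume.restrict Ω] fun x => c • sobGrad p x :=
  Lp.coeFn_smul _ _

theorem W12.norm_fst_le {n : ℕ} {Ω : Set (EucSp n)} (p : W12 Ω) : ‖(p : L2Pair Ω).fst‖ ≤ ‖p‖ := by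
  have h := WithLp.prod_norm_sq_eq_of_L2 (p : L2Pair Ω)
  refine le_of_sq_le_sq ?_ (norm_nonneg _)
  rw [Submodule.norm_coe] at h
  nlinarith [sq_nonneg ‖(p : L2Pair Ω).snd‖]

theorem W12.norm_snd_le {n : ℕ} {Ω : Set (EucSp n)} (p : W12 Ω) : ‖(p : L2Pair Ω).snd‖ ≤ ‖p‖ := by
  have h := WithLp.prod_norm_sq_eq_of_L2 (p : L2Pair Ω)
  refine le_of_sq_le_sq ?_ (norm_nonneg _)
  rw [Submodule.norm_coe] at h
  nlinarith [sq_nonneg ‖(p : L2Pair Ω).fst‖]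

theorem norm_le_fst_add_snd {n : ℕ} {Ω : Set (EucSp n)} (p : W12 Ω) :
    ‖p‖ ≤ ‖(p : L2Pair Ω).fst‖ + ‖(p : L2Pair Ω).snd‖ := by
  have h := WithLp.prod_norm_sq_eq_of_L2 (p : L2Pair Ω)
  refine le_of_sq_le_sq ?_ (by positivity)
  rw [Submodule.norm_coe] at h
  nlinarith [norm_nonneg (p : L2Pair Ω).fst, norm_nonneg (p : L2Pair Ω).snd]

theorem lpNorm_sobGrad_le {n : ℕ} {Ω A : Set (EucSp n)} (hA : A ⊆ Ω) (p : W12 Ω) :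
    lpNorm (sobGrad p) 2 (volume.restrict A) ≤ ‖p‖ := by
  refine le_trans ?_ (W12.norm_snd_le p)
  have hmono : volume.restrict A ≤ volume.restrict Ω := Measure.restrict_mono hA le_rfl
  rw [← toReal_eLpNorm ((memLp_sobGrad p).1.mono_measure hmono), Lp.norm_def]
  exact ENNReal.toReal_mono (memLp_sobGrad p).2.ne (eLpNorm_mono_measure _ hmono)

theorem mulW12_sub {n : ℕ} {Ω : Set (EucSp n)} {χ : EucSp n → ℝ} (hχ : IsTest Ω χ)
    (p q : W12 Ω) : mulW12 hχ (p - q) = mulW12 hχ p - mulW12 hχ q := by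
  refine W12.ext_ae ?_ ?_
  · filter_upwards [sobVal_mulW12 hχ (p - q), sobVal_mulW12 hχ p, sobVal_mulW12 hχ q,
      sobVal_sub p q, sobVal_sub (mulW12 hχ p) (mulW12 hχ q)] with x h1 h2 h3 h4 h5
    rw [h1, h5, h2, h3, h4]
    ring
  · filter_upwards [sobGrad_mulW12 hχ (p - q), sobGrad_mulW12 hχ p, sobGrad_mulW12 hχ q,
      sobVal_sub p q, sobGrad_sub p q, sobGrad_sub (mulW12 hχ p) (mulW12 hχ q)]
      with x h1 h2 h3 h4 h5 h6
    rw [h1, h6, h2, h3, prodGrad, prodGrad, prodGrad, h4, h5]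
    module

theorem exists_norm_mulW12_le {n : ℕ} {Ω : Set (EucSp n)} {χ : EucSp n → ℝ} (hχ : IsTest Ω χ) :
    ∃ c : ℝ, ∀ p : W12 Ω, ‖mulW12 hχ p‖ ≤ c * ‖p‖ := by
  obtain ⟨c, hc, hb, hg⟩ := hχ.exists_bound
  refine ⟨c + (c + c), fun p => (norm_le_fst_add_snd _).trans ?_⟩
  rw [add_mul]
  have hp : ‖(memLp_mul_sobVal hχ p).toLp‖ ≤ c * ‖(p : L2Pair Ω).fst‖ :=
    Lp.norm_le_mul_norm_of_ae_le_mul (by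
      filter_upwards [(memLp_mul_sobVal hχ p).coeFn_toLp] with x hx
      rw [hx, norm_mul]
      exact mul_le_mul_of_nonneg_right (hb x) (norm_nonneg _))
  have hp2 : ‖(memLp_smul_sobGrad hχ p).toLp‖ ≤ c * ‖(p : L2Pair Ω).snd‖ :=
    Lp.norm_le_mul_norm_of_ae_le_mul (by
      filter_upwards [(memLp_smul_sobGrad hχ p).coeFn_toLp] with x hx
      rw [hx, norm_smul]
      exact mul_le_mul_of_nonneg_right (hb x) (norm_nonneg _))
  have hp3 : ‖(memLp_smul_gradient hχ p).toLp‖ ≤ c * ‖(p : L2Pair Ω).fst‖ :=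
    Lp.norm_le_mul_norm_of_ae_le_mul (by
      filter_upwards [(memLp_smul_gradient hχ p).coeFn_toLp] with x hx
      rw [hx, norm_smul, mul_comm]
      exact mul_le_mul_of_nonneg_right (hg x) (norm_nonneg _))
  have h1 := mul_le_mul_of_nonneg_left (W12.norm_fst_le p) hc
  have h2 := mul_le_mul_of_nonneg_left (W12.norm_snd_le p) hc
  refine add_le_add (hp.trans h1) ?_
  rw [add_mul]
  refine le_trans ?_ (add_le_add (hp2.trans h2) (hp3.trans h1))
  change ‖(memLp_prodGrad hχ p).toLp‖ ≤ _
  exact (congrArg norm (MemLp.toLp_add (memLp_smul_sobGrad hχ p)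
    (memLp_smul_gradient hχ p))).trans_le (norm_add_le _ _)

theorem IsTestClass.mulW12 {n : ℕ} {Ω : Set (EucSp n)} {χ : EucSp n → ℝ} (hχ : IsTest Ω χ)
    {p : W12 Ω} (hp : IsTestClass p) : IsTestClass (mulW12 hχ p) := by
  obtain ⟨η, hη, h1, h2⟩ := hp
  refine ⟨fun x => χ x * η x, ⟨hχ.1.mul hη.1, hχ.2.1.mul_right,
    tsupport_mul_subset_left.trans hχ.2.2⟩, ?_, ?_⟩
  · filter_upwards [sobVal_mulW12 hχ p, h1] with x h3 h4
    rw [h3, h4]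
  · filter_upwards [sobGrad_mulW12 hχ p, h1, h2] with x h3 h4 h5
    rw [h3, prodGrad, h4, h5, gradient_mul hχ.1 hη.1]

theorem isTestClass_of_mem_span {n : ℕ} {Ω : Set (EucSp n)} {p : W12 Ω}
    (hp : p ∈ Submodule.span ℝ {u : W12 Ω | IsTestClass u}) : IsTestClass p := by
  induction hp using Submodule.span_induction with
  | mem p h => exact h
  | zero =>
    refine ⟨fun _ => 0, ⟨contDiff_const, HasCompactSupport.zero, ?_⟩,
      Lp.coeFn_zero _ _ _, ?_⟩
    · exact (closure_minimal (fun x hx => absurd rfl hx) isClosed_empty).trans (empty_subset _)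
    · refine (Lp.coeFn_zero (EucSp n) 2 (volume.restrict Ω)).trans (ae_of_all _ fun x => ?_)
      simp [gradient]
  | add p q _ _ hp hq =>
    obtain ⟨η, hη, h1, h2⟩ := hp
    obtain ⟨θ, hθ, h3, h4⟩ := hq
    refine ⟨fun x => η x + θ x, ⟨hη.1.add hθ.1, hη.2.1.add hθ.2.1,
      (tsupport_add η θ).trans (union_subset hη.2.2 hθ.2.2)⟩, ?_, ?_⟩
    · filter_upwards [sobVal_add p q, h1, h3] with x h5 h6 h7
      rw [h5, h6, h7]
    · filter_upwards [sobGrad_add p q, h2, h4] with x h5 h6 h7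
      rw [h5, h6, h7, gradient, gradient, gradient,
        fderiv_fun_add (hη.1.differentiable (by simp) x) (hθ.1.differentiable (by simp) x),
        map_add]
  | smul c p _ hp =>
    obtain ⟨η, hη, h1, h2⟩ := hp
    refine ⟨fun x => c * η x, ⟨contDiff_const.mul hη.1, hη.2.1.mul_left,
      tsupport_mul_subset_right.trans hη.2.2⟩, ?_, ?_⟩
    · filter_upwards [sobVal_smul c p, h1] with x h5 h6
      rw [h5, h6]
    · filter_upwards [sobGrad_smul c p, h2] with x h5 h6
      rw [h5, h6, gradient, gradient,
        fderiv_const_mul (hη.1.differentiable (by simp) x), map_smulₛₗ]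
      simp

/-- A cutoff function that is `1` on the ball supporting `φ` does not change `φ`. -/
theorem mulW12_eq_self {n : ℕ} {Ω : Set (EucSp n)} (hΩ : IsOpen Ω) (hfin : volume Ω ≠ ∞)
    {χ : EucSp n → ℝ} (hχ : IsTest Ω χ) {φ : W12 Ω} {y : EucSp n} {r : ℝ} (hr : 0 < r)
    (hφ : SupportedInBall φ y r) (h1 : ∀ x ∈ ball y r, χ x = 1) : mulW12 hχ φ = φ := by
  have hz := ae_eq_zero_of_supportedInBall hΩ hfin hr hφ
  have h2 : ∀ x ∈ ball y r, gradient χ x = 0 := fun x hx =>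
    gradient_eq_zero_of_eventuallyEq_const (c := 1) (by
      filter_upwards [isOpen_ball.mem_nhds hx] with z hz using h1 z hz)
  refine W12.ext_ae ?_ ?_
  · filter_upwards [sobVal_mulW12 hχ φ, hz] with x h3 h4
    rw [h3]
    by_cases hx : x ∈ ball y r
    · rw [h1 x hx, one_mul]
    · rw [(h4 hx).1, mul_zero]
  · filter_upwards [sobGrad_mulW12 hχ φ, hz] with x h3 h4
    rw [h3, prodGrad]
    by_cases hx : x ∈ ball y r
    · rw [h1 x hx, h2 x hx, one_smul, smul_zero, add_zero]
    · rw [(h4 hx).1, (h4 hx).2, smul_zero, zero_smul, add_zero]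

theorem divForm_sub {n : ℕ} {Ω : Set (EucSp n)} {Γ : EucSp n → EucSp n} {ψ p q : W12 Ω}
    (hp : IntegrableOn (divIntegrand Γ ψ p) Ω) (hq : IntegrableOn (divIntegrand Γ ψ q) Ω) :
    divForm Γ ψ (p - q) = divForm Γ ψ p - divForm Γ ψ q := by
  have h : divIntegrand Γ ψ (p - q) =ᵐ[volume.restrict Ω]
      fun x => divIntegrand Γ ψ p x - divIntegrand Γ ψ q x := by
    filter_upwards [sobVal_sub p q, sobGrad_sub p q] with x h1 h2
    rw [divIntegrand, divIntegrand, divIntegrand, h1, h2, ← inner_sub_right]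
    congr 1
    module
  rw [divForm, integral_congr_ae h, integral_sub hp hq, divForm, divForm]
  ring

theorem normL12_nonneg {n : ℕ} {Ω : Set (EucSp n)} (ψ : W12 Ω) (y : EucSp n) {r s : ℝ}
    (h : r < s) : 0 ≤ normL12 ψ y r s :=
  add_nonneg (div_nonneg lpNorm_nonneg (sub_nonneg.2 h.le)) lpNorm_nonneg

/-- A function of `W₀^{1,2}` supported in a ball is a limit of test functions supported in a
slightly larger ball. -/
theorem exists_seq_isTestClass {n : ℕ} {Ω : Set (EucSp n)} (hΩ : IsOpen Ω)
    (hfin : volume Ω ≠ ∞) {y : EucSp n} {r s : ℝ} (hr : 0 < r) (hrs : r < s)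
    (hy : ball y s ⊆ Ω) {φ : W12 Ω} (hφ0 : φ ∈ W012 Ω) (hφ : SupportedInBall φ y r) :
    ∃ q : ℕ → W12 Ω, (∀ k, IsTestClass (q k)) ∧ (∀ k, SupportedInBall (q k) y s) ∧
      Tendsto q atTop (𝓝 φ) := by
  obtain ⟨χ, hχ, hχ1, -, -⟩ := exists_cutoff_between_balls y hr hrs
  have hχΩ : IsTest Ω χ := ⟨hχ.1, hχ.2.1, hχ.2.2.trans hy⟩
  obtain ⟨c, hc⟩ := exists_norm_mulW12_le hχΩ
  have hmem : φ ∈ closure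
      (Submodule.span ℝ {u : W12 Ω | IsTestClass u} : Set (W12 Ω)) := hφ0
  obtain ⟨p, hp, hpφ⟩ := mem_closure_iff_seq_limit.1 hmem
  have hφe : mulW12 hχΩ φ = φ := mulW12_eq_self hΩ hfin hχΩ hr hφ fun x hx =>
    hχ1 x (ball_subset_closedBall hx)
  refine ⟨fun k => mulW12 hχΩ (p k), fun k => (isTestClass_of_mem_span (hp k)).mulW12 hχΩ,
    fun k => ?_, ?_⟩
  · filter_upwards [sobVal_mulW12 hχΩ (p k)] with x hx hxb
    rw [hx, image_eq_zero_of_notMem_tsupport fun h =>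
      hxb (ball_subset_closedBall (hχ.2.2 h)), zero_mul]
  · rw [tendsto_iff_norm_sub_tendsto_zero] at hpφ ⊢
    refine squeeze_zero (fun _ => norm_nonneg _) (fun k => ?_) (by simpa using hpφ.const_mul c)
    rw [← hφe, ← mulW12_sub, hφe]
    exact hc _

theorem SupportedInBall.sub {n : ℕ} {Ω : Set (EucSp n)} {p q : W12 Ω} {y : EucSp n} {r : ℝ}
    (hp : SupportedInBall p y r) (hq : SupportedInBall q y r) : SupportedInBall (p - q) y r := by
  have h := sobVal_sub p q
  unfold SupportedInBall at hp hq ⊢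
  filter_upwards [hp, hq, h] with x h1 h2 h3 h4
  rw [h3, h1 h4, h2 h4, sub_zero]

theorem SupportedInBall.mono {n : ℕ} {Ω : Set (EucSp n)} {p : W12 Ω} {y : EucSp n} {r s : ℝ}
    (hp : SupportedInBall p y r) (hrs : r ≤ s) : SupportedInBall p y s := by
  unfold SupportedInBall at hp ⊢
  filter_upwards [hp] with x hx hxb
  exact hx fun h => hxb (closedBall_subset_closedBall hrs h)

set_option maxHeartbeats 1000000 in
/-- An operator that agrees with `div Γ` on test functions agrees with it on all functions of
`W₀^{1,2}` whose support stays away from the boundary. -/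
theorem IsDivOperator.apply_eq {n : ℕ} (hn : 3 ≤ n) {Ω : Set (EucSp n)} (hΩ : IsOpen Ω)
    (hfin : volume Ω ≠ ∞) {Γ : EucSp n → EucSp n} (hΓ : MemLp Γ 2 (volume.restrict Ω))
    {V : W12 Ω →ₗ[ℝ] Wm12 Ω} (hV : IsDivOperator Γ V) {y : EucSp n} {r : ℝ} (hr : 0 < r)
    (hy : ball y (2 * r) ⊆ Ω) {M : ℝ} (hM0 : 0 ≤ M)
    (hM : ∀ ε : ℝ, 0 < ε → ∀ x ∈ Ω,
      newtonPotential (fieldMeasure Γ (ball y (3 / 2 * r))) ε x ≤ M)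
    (ψ : W12 Ω) {φ : W12 Ω} (hφ0 : φ ∈ W012 Ω) (hφ : SupportedInBall φ y r) :
    V ψ ⟨φ, hφ0⟩ = divForm Γ ψ φ := by
  have hsub : ball y (3 / 2 * r) ⊆ Ω := (ball_subset_ball (by linarith)).trans hy
  obtain ⟨q, hqt, hqs, hqφ⟩ := exists_seq_isTestClass hΩ hfin hr (s := 3 / 2 * r) (by linarith)
    hsub hφ0 hφ
  have hB0 := cutoffConst_pos
  have hbound := integrableOn_divIntegrand_and_abs_divForm_le hn hΩ hfin hΓ
    (by positivity : 0 < 3 / 2 * r) (by linarith : 3 / 2 * r < 2 * r) hy hM0 hM ψ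
  have hφs : SupportedInBall φ y (3 / 2 * r) :=
    hφ.mono (by linarith)
  have hds : ∀ k, SupportedInBall (q k - φ) y (3 / 2 * r) := fun k =>
    (hqs k).sub hφs
  have hq0 : ∀ k, q k ∈ W012 Ω := fun k =>
    Submodule.le_topologicalClosure _ (Submodule.subset_span (hqt k))
  have h1 : Tendsto (fun k => V ψ ⟨q k, hq0 k⟩) atTop (𝓝 (V ψ ⟨φ, hφ0⟩)) :=
    ((V ψ).continuous.tendsto ⟨φ, hφ0⟩).comp (tendsto_subtype_rng.2 hqφ)
  refine tendsto_nhds_unique h1 (tendsto_iff_norm_sub_tendsto_zero.2 ?_)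
  set K := (cutoffConst + 2) * √(M / traceConst n) * normL12 ψ y (3 / 2 * r) (2 * r) with hK
  have hK0 : 0 ≤ K := mul_nonneg (by positivity) (normL12_nonneg ψ y (by linarith))
  have hlim : Tendsto (fun k => K * ‖q k - φ‖) atTop (𝓝 0) := by
    simpa using (tendsto_iff_norm_sub_tendsto_zero.1 hqφ).const_mul K
  refine squeeze_zero (fun _ => norm_nonneg _) (fun k => ?_) hlim
  have e1 : V ψ ⟨q k, hq0 k⟩ = divForm Γ ψ (q k) := hV ψ ⟨q k, hq0 k⟩ (hqt k)
  have e2 : V ψ ⟨q k, hq0 k⟩ - divForm Γ ψ φ = divForm Γ ψ (q k - φ) :=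
    (congrArg (· - divForm Γ ψ φ) e1).trans
      (divForm_sub (hbound _ (hqs k)).1 (hbound _ hφs).1).symm
  refine (congrArg abs e2).trans_le ?_
  exact (hbound _ (hds k)).2.trans (mul_le_mul_of_nonneg_left (lpNorm_sobGrad_le hsub _) hK0)

/-! ### Uniform constants -/

theorem exists_finite_cover_unitBall (n : ℕ) {r₀ : ℝ} (hr₀ : 0 < r₀) :
    ∃ t : Finset (EucSp n), (∀ y ∈ t, y ∈ unitBall n) ∧ unitBall n ⊆ ⋃ y ∈ t, ball y r₀ := by
  have htb : TotallyBounded (unitBall n) :=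
    (isCompact_closedBall (0 : EucSp n) 1).totallyBounded.subset ball_subset_closedBall
  obtain ⟨t, ht, hfin, hcov⟩ := finite_approx_of_totallyBounded htb r₀ hr₀
  exact ⟨hfin.toFinset, fun y hy => ht (hfin.mem_toFinset.1 hy), by simpa using hcov⟩

/-- The mass of `|Γ|²` on the unit ball is controlled by a covering with balls of radius `r₀`. -/
theorem lintegral_enorm_sq_unitBall_le {n : ℕ} (hn : 3 ≤ n) {Γ : EucSp n → EucSp n}
    (hΓ : MemLp Γ 2 (volume.restrict (unitBall n))) {C w r₀ : ℝ} (hC : 0 ≤ C) (hw : 0 ≤ w)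
    (hr₀ : 0 < r₀) {t : Finset (EucSp n)} (ht : ∀ y ∈ t, y ∈ unitBall n)
    (hcov : unitBall n ⊆ ⋃ y ∈ t, ball y r₀)
    (h : ∀ (i : Fin n), ∀ y ∈ unitBall n,
      √(⨍ x in unitBall n ∩ ball y r₀, |Γ x i| ^ 2) ≤ C * (w / r₀)) :
    ∫⁻ x in unitBall n, ‖Γ x‖ₑ ^ 2 ≤
      ENNReal.ofReal (t.card * (n * unitBallVolume n * C ^ 2 * (w ^ 2 * r₀ ^ (n - 2)))) := by
  have hV := unitBallVolume_pos n
  set m := n * unitBallVolume n * C ^ 2 * (w ^ 2 * r₀ ^ (n - 2))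
  rw [← withDensity_apply' _ (unitBall n)]
  calc _ ≤ (volume.withDensity fun x => ‖Γ x‖ₑ ^ 2) (⋃ y ∈ t, unitBall n ∩ ball y r₀) := by
        refine measure_mono ?_
        rw [← inter_iUnion₂]
        exact subset_inter subset_rfl hcov
    _ ≤ ∑ y ∈ t, (volume.withDensity fun x => ‖Γ x‖ₑ ^ 2) (unitBall n ∩ ball y r₀) :=
        measure_biUnion_finset_le _ _
    _ ≤ ∑ y ∈ t, ENNReal.ofReal m := by
        refine Finset.sum_le_sum fun y hy => ?_
        rw [withDensity_apply' _ _]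
        exact lintegral_enorm_sq_ball_le hn hΓ hC hw hr₀ (ht y hy) fun i => h i y (ht y hy)
    _ = ENNReal.ofReal (t.card * m) := by
        rw [Finset.sum_const, nsmul_eq_mul, ENNReal.ofReal_mul (p := (t.card : ℝ)) (by positivity),
          ENNReal.ofReal_natCast]

/-- The Newton potential of `|Γ|²` is bounded by the square Dini integral at the radius `ρ` when
the total mass on `A` is at most `N` times the bound for a ball of radius `ρ`. -/
theorem newtonPotential_le_sqrtDini {n : ℕ} (hn : 3 ≤ n) {Γ : EucSp n → EucSp n}
    (hΓ : MemLp Γ 2 (volume.restrict (unitBall n))) {ω₁ : ℝ → ℝ} (hω : IsModulus ω₁)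
    (hi : IntegrableOn (fun r => ω₁ r ^ 2 / r) (Ioc 0 1)) {C r₀ : ℝ} (hC : 0 ≤ C) (hr₀ : r₀ ≤ 1)
    (h : ∀ (i : Fin n) (r : ℝ), 0 < r → r ≤ r₀ → ∀ y ∈ unitBall n,
      √(⨍ x in unitBall n ∩ ball y r, |Γ x i| ^ 2) ≤ C * (ω₁ r / r))
    {A : Set (EucSp n)} (hA : A ⊆ unitBall n) {ρ : ℝ} (hρ : 0 < ρ)
    (hρ₀ : ρ ≤ r₀) {N : ℝ} (hN : 0 ≤ N)
    (hm : ∫⁻ x in A, ‖Γ x‖ₑ ^ 2 ≤ ENNReal.ofReal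
      (N * (n * unitBallVolume n * C ^ 2 * (ω₁ ρ ^ 2 * ρ ^ (n - 2)))))
    {ε : ℝ} (hε : 0 < ε) {x : EucSp n} (hx : x ∈ unitBall n) :
    newtonPotential (fieldMeasure Γ A) ε x ≤
      2 ^ (n - 1) * (n * unitBallVolume n) * (1 + 4 * N) * (C * sqrtDini ω₁ ρ) ^ 2 := by
  have hV := unitBallVolume_pos n
  refine (newtonPotential_fieldMeasure_le hn hΓ hω hi hC hr₀ h hA hρ hρ₀ (by positivity) hm hε
    hx).trans ?_
  have h8 := sq_le_mul_sqrtDini_sq hω hi hρ (hρ₀.trans hr₀)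
  have e : (2 : ℝ) ^ (n - 1) = 2 * 2 ^ (n - 2) := by
    rw [← pow_succ']
    congr 1
    omega
  set D := n * unitBallVolume n with hD
  have hD0 : 0 ≤ D := by positivity
  calc _ = 2 ^ (n - 1) * (D * C ^ 2) * sqrtDini ω₁ ρ ^ 2 +
        2 ^ (n - 2) * (N * (D * C ^ 2)) * ω₁ ρ ^ 2 := by
        field_simp
    _ ≤ 2 ^ (n - 1) * (D * C ^ 2) * sqrtDini ω₁ ρ ^ 2 +
        2 ^ (n - 2) * (N * (D * C ^ 2)) * (8 * sqrtDini ω₁ ρ ^ 2) := by gcongr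
    _ = _ := by
        rw [e]
        ring

/-- The constant in the bound of the Newton potential by the square Dini integral, when the total
mass is at most `N` times the bound for a ball. -/
def potentialConst (n : ℕ) (N : ℝ) : ℝ := 2 ^ (n - 1) * (n * unitBallVolume n) * (1 + 4 * N)

theorem potentialConst_pos {n : ℕ} (hn : 3 ≤ n) {N : ℝ} (hN : 0 ≤ N) : 0 < potentialConst n N := by
  have hV := unitBallVolume_pos n
  have : (0 : ℝ) < n := by exact_mod_cast (by omega : 0 < n)
  unfold potentialConst
  positivity

theorem potentialConst_mono {n : ℕ} {N N' : ℝ} (h : N ≤ N') :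
    potentialConst n N ≤ potentialConst n N' := by
  have hV := unitBallVolume_pos n
  unfold potentialConst
  gcongr

/-- The multiplier inequality for `div Γ` from a bound for the Newton potential by the square Dini
integral at some radius `ρ ≤ s`. -/
theorem abs_divForm_le_of_newtonPotential_le {n : ℕ} (hn : 3 ≤ n) {Γ : EucSp n → EucSp n}
    (hΓ : MemLp Γ 2 (volume.restrict (unitBall n))) {ω₁ : ℝ → ℝ}
    (hi : IntegrableOn (fun r => ω₁ r ^ 2 / r) (Ioc 0 1)) {C : ℝ} (hC : 0 ≤ C)
    {κ ρ r s : ℝ} {y : EucSp n} (hκ : 0 ≤ κ) (hρ : 0 < ρ) (hρs : ρ ≤ s) (hr : 0 < r) (hrs : r < s)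
    (hs1 : s ≤ 1) (hy : ball y s ⊆ unitBall n)
    (hpot : ∀ ε : ℝ, 0 < ε → ∀ x ∈ unitBall n,
      newtonPotential (fieldMeasure Γ (ball y r)) ε x ≤ κ * (C * sqrtDini ω₁ ρ) ^ 2)
    (ψ φ : W12 (unitBall n)) (hφ : SupportedInBall φ y r) :
    |divForm Γ ψ φ| ≤ (cutoffConst + 2) * √(κ / traceConst n) * C * sqrtDini ω₁ s *
      normL12 ψ y r s * lpNorm (sobGrad φ) 2 (volume.restrict (ball y r)) := by
  have hB0 := cutoffConst_pos
  have hc := traceConst_pos hn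
  have hρ0 := sqrtDini_nonneg ω₁ ρ
  refine (integrableOn_divIntegrand_and_abs_divForm_le hn isOpen_ball measure_ball_lt_top.ne hΓ
    hr hrs hy (by positivity) hpot ψ φ hφ).2.trans ?_
  have hs : √(κ * (C * sqrtDini ω₁ ρ) ^ 2 / traceConst n) =
      √(κ / traceConst n) * (C * sqrtDini ω₁ ρ) := by
    rw [mul_div_right_comm, Real.sqrt_mul (by positivity), Real.sqrt_sq (by positivity)]
  have hmono := sqrtDini_mono hi hρ.le hρs hs1
  have hn0 := normL12_nonneg ψ y hrs
  have hl0 : 0 ≤ lpNorm (sobGrad φ) 2 (volume.restrict (ball y r)) := lpNorm_nonneg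
  rw [hs]
  refine mul_le_mul_of_nonneg_right (mul_le_mul_of_nonneg_right ?_ hn0) hl0
  calc _ = (cutoffConst + 2) * √(κ / traceConst n) * C * sqrtDini ω₁ ρ := by ring
    _ ≤ _ := by gcongr

set_option maxHeartbeats 1000000 in
theorem theorem6p3 (n : ℕ) (hn : 3 ≤ n) :
    ∃ K : ℝ, 0 < K ∧ ∀ r₀ : ℝ, 0 < r₀ → r₀ ≤ 1 → ∃ K' : ℝ, 0 < K' ∧
      ∀ (Γ : EucSp n → EucSp n) (ω₁ : ℝ → ℝ) (C : ℝ), 0 ≤ C →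
        MemLp Γ 2 (volume.restrict (unitBall n)) →
        IsModulus ω₁ →
        (∀ (i : Fin n) (r : ℝ), 0 < r → r ≤ r₀ → ∀ y ∈ unitBall n,
          √(⨍ x in unitBall n ∩ ball y r, |Γ x i| ^ 2) ≤ C * (ω₁ r / r)) →
        IntegrableOn (fun r => ω₁ r ^ 2 / r) (Ioc 0 r₀) →
        IntegrableOn (fun r => 1 / r * √(∫ s in (0 : ℝ)..r, ω₁ s ^ 2 / s)) (Ioc 0 r₀) →
        IsDiniModulus (sqrtDini ω₁) ∧
        (∀ (r : ℝ) (y : EucSp n), 0 < r → r ≤ 1 / 2 → ball y (2 * r) ⊆ unitBall n →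
          ∀ (ψ : W12 (unitBall n)) (φ : W012 (unitBall n)),
            SupportedInBall (φ : W12 (unitBall n)) y r →
              IntegrableOn (divIntegrand Γ ψ φ) (unitBall n)) ∧
        MultiplierBound (fun ψ φ => divForm Γ ψ φ) (fun s => K * C * sqrtDini ω₁ s) (r₀ / 2) ∧
        MultiplierBound (fun ψ φ => divForm Γ ψ φ) (fun s => K' * C * sqrtDini ω₁ s) (1 / 2) ∧
        ∀ V : W12 (unitBall n) →ₗ[ℝ] Wm12 (unitBall n), IsDivOperator Γ V →
          MultiplierBound (fun ψ φ => V ψ φ) (fun s => K * C * sqrtDini ω₁ s) (r₀ / 2) ∧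
          MultiplierBound (fun ψ φ => V ψ φ) (fun s => K' * C * sqrtDini ω₁ s) (1 / 2) := by
  have hc := traceConst_pos hn
  have hB0 := cutoffConst_pos
  have hκ1 := potentialConst_pos hn zero_le_one
  refine ⟨(cutoffConst + 2) * √(potentialConst n 1 / traceConst n), by positivity, fun r₀ hr₀ hr₀1 => ?_⟩
  obtain ⟨t, ht, hcov⟩ := exists_finite_cover_unitBall n hr₀
  -- The summand `1` makes the constant for all radii at least the one for small radii.
  set N : ℝ := t.card + 1 with hN
  have hN0 : 0 ≤ N := by positivity
  have hN1 : 1 ≤ N := by simp [hN]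
  have hκN := potentialConst_pos hn hN0
  refine ⟨(cutoffConst + 2) * √(potentialConst n N / traceConst n), by positivity, ?_⟩
  intro Γ ω₁ C hC hΓ hω h hi₀ hD
  have hi := hω.integrableOn_Ioc_one hr₀ hr₀1 hi₀
  have hV := unitBallVolume_pos n
  have hB1 : volume (unitBall n) ≠ ∞ := measure_ball_lt_top.ne
  -- At radii `r ≤ r₀` the mass of `|Γ|²` on the ball is controlled at the radius `r` itself.
  have potSmall : ∀ (r : ℝ) (y : EucSp n), 0 < r → r ≤ r₀ → ball y r ⊆ unitBall n →
      ∀ ε : ℝ, 0 < ε → ∀ x ∈ unitBall n, newtonPotential (fieldMeasure Γ (ball y r)) ε x ≤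
        potentialConst n 1 * (C * sqrtDini ω₁ r) ^ 2 := by
    intro r y hr hrr hy ε hε x hx
    refine newtonPotential_le_sqrtDini hn hΓ hω hi hC hr₀1 h hy hr hrr zero_le_one ?_ hε hx
    rw [one_mul, ← inter_eq_self_of_subset_right hy]
    have hyB : y ∈ unitBall n := hy (mem_ball_self hr)
    exact lintegral_enorm_sq_ball_le hn hΓ hC (hω.nonneg hr.le (hrr.trans hr₀1)) hr hyB
      fun i => h i r hr hrr y hyB
  -- At larger radii it is controlled at the radius `r₀`, by covering the unit ball.
  have potAll : ∀ A ⊆ unitBall n,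
      ∀ ε : ℝ, 0 < ε → ∀ x ∈ unitBall n, newtonPotential (fieldMeasure Γ A) ε x ≤
        potentialConst n N * (C * sqrtDini ω₁ r₀) ^ 2 := by
    intro A hA ε hε x hx
    refine newtonPotential_le_sqrtDini hn hΓ hω hi hC hr₀1 h hA hr₀ le_rfl hN0 ?_ hε hx
    have hw := hω.nonneg hr₀.le hr₀1
    refine (lintegral_mono_set hA).trans ((lintegral_enorm_sq_unitBall_le hn hΓ hC hw hr₀ ht hcov
      fun i y hy => h i r₀ hr₀ le_rfl y hy).trans (ENNReal.ofReal_le_ofReal ?_))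
    gcongr
    simp [hN]
  have hsub : ∀ {r s : ℝ} {y : EucSp n}, s ≤ 2 * r → ball y (2 * r) ⊆ unitBall n →
      ball y s ⊆ unitBall n := fun hs hy => (ball_subset_ball hs).trans hy
  have mSmall : MultiplierBound (fun ψ (φ : W012 (unitBall n)) => divForm Γ ψ φ)
      (fun s => (cutoffConst + 2) * √(potentialConst n 1 / traceConst n) * C * sqrtDini ω₁ s) (r₀ / 2) := by
    intro r y hr hrr hy ψ φ hφ s hrs hs
    exact abs_divForm_le_of_newtonPotential_le hn hΓ hi hC hκ1.le hr hrs.le hr hrs (by linarith) (hsub hs hy)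
      (potSmall r y hr (by linarith) (hsub (by linarith) hy)) ψ φ hφ
  have mAll : MultiplierBound (fun ψ (φ : W012 (unitBall n)) => divForm Γ ψ φ)
      (fun s => (cutoffConst + 2) * √(potentialConst n N / traceConst n) * C * sqrtDini ω₁ s) (1 / 2) := by
    intro r y hr hrr hy ψ φ hφ s hrs hs
    rcases le_or_gt r r₀ with hle | hgt
    · refine abs_divForm_le_of_newtonPotential_le hn hΓ hi hC hκN.le hr hrs.le hr hrs (by linarith) (hsub hs hy) ?_ ψ φ hφ
      intro ε hε x hx
      refine (potSmall r y hr hle (hsub (by linarith) hy) ε hε x hx).trans ?_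
      gcongr
      exact potentialConst_mono hN1
    · exact abs_divForm_le_of_newtonPotential_le hn hΓ hi hC hκN.le hr₀ (by linarith) hr hrs (by linarith) (hsub hs hy)
        (potAll _ (hsub (by linarith) hy)) ψ φ hφ
  refine ⟨isDiniModulus_sqrtDini hω hr₀ hr₀1 hi₀ hD, ?_, mSmall, mAll, ?_⟩
  · intro r y hr hrr hy ψ φ hφ
    exact (integrableOn_divIntegrand_and_abs_divForm_le hn isOpen_ball hB1 hΓ hr (by linarith : r < 2 * r) hy (by positivity)
      (potAll _ (hsub (by linarith) hy)) ψ φ hφ).1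
  · intro V hVdiv
    have hVeq : ∀ (r : ℝ) (y : EucSp n), 0 < r → ball y (2 * r) ⊆ unitBall n →
        ∀ (ψ : W12 (unitBall n)) (φ : W012 (unitBall n)),
          SupportedInBall (φ : W12 (unitBall n)) y r → V ψ φ = divForm Γ ψ φ :=
      fun r y hr hy ψ φ hφ => hVdiv.apply_eq hn isOpen_ball hB1 hΓ hr hy (by positivity)
        (potAll _ (hsub (by linarith) hy)) ψ φ.2 hφ
    refine ⟨fun r y hr hrr hy ψ φ hφ s hrs hs => ?_, fun r y hr hrr hy ψ φ hφ s hrs hs => ?_⟩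
    · refine (congrArg abs (hVeq r y hr hy ψ φ hφ)).trans_le ?_
      exact mSmall r y hr hrr hy ψ φ hφ s hrs hs
    · refine (congrArg abs (hVeq r y hr hy ψ φ hφ)).trans_le ?_
      exact mAll r y hr hrr hy ψ φ hφ s hrs hs

end
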